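/- **Setting.** Let $\mathcal U,\mathcal M$ be separable real Hilbert spaces, $\mathcal Z=\mathbb R^{d_z}$ with the Euclidean norm, $\mu_m$ a Borel probability measure on $\mathcal M$ with $\int\|m\|_{\mathcal M}^p\,d\mu_m<\infty$ for some real $p\ge 2$, $\mathcal Z_{ad}\subset\mathcal Z$ nonempty, convex and compact, and $\mathcal B\supset\mathcal Z_{ad}$ open. Suppose: (1) $u:\mathcal M\times\mathcal B\to\mathcal U$ is continuously (Fréchet) differentiable, and there are $\kappa_u,\kappa_{u_z}>0$ such that for all $m_1,m_2\in\mathcal M$, $z_1,z_2\in\mathcal B$, $$\|u(m_2,z_2)-u(m_1,z_1)\|_{\mathcal U}\le\kappa_u\big(\|m_2-m_1\|_{\mathcal M}+\|z_2-z_1\|_{\mathcal Z}\big),$$ $$\|D_zu(m_2,z_2)-D_zu(m_1,z_1)\|_{\mathrm{HS}(\mathcal Z,\mathcal U)}\le\kappa_{u_z}\big(\|m_2-m_1\|_{\mathcal M}+\|z_2-z_1\|_{\mathcal Z}\big),$$ where $\mathrm{HS}$ denotes the Hilbert–Schmidt norm. (2) $Q:\mathcal U\times\mathcal M\times\mathcal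 B\to\mathbb R$ is twice continuously differentiable; there are $\kappa_{Q_u},\kappa_{Q_{uz}}>0$ such that for all $u_1,u_2\in\mathcal U$, $m\in\mathcal M$, $z\in\mathcal B$, $$\|D_uQ(u_2,m,z)-D_uQ(u_1,m,z)\|_{\mathcal U'}\le\kappa_{Q_u}\|u_2-u_1\|_{\mathcal U},\qquad \|D_{uz}Q(u_2,m,z)-D_{uz}Q(u_1,m,z)\|_{\mathcal L(\mathcal U,\mathcal Z')}\le\kappa_{Q_{uz}}\|u_2-u_1\|_{\mathcal U};$$ and $|Q(0,m,z)|$, $\|D_uQ(0,m,z)\|_{\mathcal U'}$, $\|D_zQ(0,m,z)\|_{\mathcal Z'}$ and $\|D_{uz}Q(0,m,z)\|_{\mathcal L(\mathcal U,\mathcal Z')}$ are bounded uniformly in $m\in\mathcal M$, $z\in\mathcal B$. (3) $\mathcal P:\mathcal Z\to\mathbb R$ is a function for which $\mathcal J(z):=\mathbb E_{m\sim\mu_m}[Q(u(m,z),m,z)]+\mathcal P(z)$ belongs to $C^1(\mathcal B;\mathbb R)$ and is strongly convex, i.e. for some $\lambda>0$ and all $z_1,z_2\in\mathcal B$, $$\mathcal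 J(z_2)\ge\mathcal J(z_1)+\langle D_z\mathcal J(z_1),z_2-z_1\rangle+\tfrac{\lambda}{2}\|z_2-z_1\|_{\mathcal Z}^2 .$$ Let $\{\phi_i\}_{i\ge1}$, $\{\psi_i\}_{i\ge1}$ be orthonormal bases of $\mathcal U$ and $\mathcal M$ (infinite, or finite if the space is finite-dimensional), and let $b_u\in\mathcal U$, $b_m\in\mathcal M$ be arbitrary. A *GELU network* $g:\mathbb R^n\to\mathbb R^k$ is a dense feedforward network with at least one hidden layer, $a_0=x$, $a_i=\sigma(W_{i-1}a_{i-1}+b_{i-1})$ for $1\le i\le L$, $g(x)=W_La_L+b_L$, where $\sigma(t)=t\,\Phi(t)$ is applied componentwise and $\Phi$ is the standard normal distribution function. **Theorem 3.2.** The function $\mathcal J$ has a unique minimizer $z^\star$ over $\mathcal Z_{ad}$. For every $\varepsilon>0$ there exist ranks $r_u,r_m$ (not exceeding the dimensions of $\mathcal U,\mathcal M$) and a GELU network $g_\theta:\mathbb R^{r_m}\times\mathbb R^{d_z}\to\mathbb R^{r_u}$ such that, for the reduced-basis neural operator $$u_\theta(m,z)=\sum_{i=1}^{r_u}\Big[g_\theta\big((\langle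 m-b_m,\psi_j\rangle_{\mathcal M})_{j=1}^{r_m},z\big)\Big]_i\phi_i+b_u,$$ the surrogate objective $\mathcal J_\theta(z):=\mathbb E_{m\sim\mu_m}[Q(u_\theta(m,z),m,z)]+\mathcal P(z)$ is well defined (the integrand is integrable for every $z\in\mathcal B$) and continuously differentiable on $\mathcal B$, and every $z^\dagger\in\mathcal Z_{ad}$ satisfying the first-order optimality conditions $$\langle D_z\mathcal J_\theta(z^\dagger),z-z^\dagger\rangle\ge0\qquad\text{for all }z\in\mathcal Z_{ad}$$ satisfies $$\|z^\star-z^\dagger\|_{\mathcal Z}\le\varepsilon\qquad\text{and}\qquad\mathcal J(z^\dagger)-\mathcal J(z^\star)\le\varepsilon^2 .$$ -/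

import Mathlib

open MeasureTheory

namespace RBNO

noncomputable section

/-- The design space `ℝ^d` with its Euclidean norm. -/
abbrev Design (d : ℕ) : Type := EuclideanSpace ℝ (Fin d)

/-! ### GELU networks -/

/-- The Gaussian error linear unit `x ↦ x Φ(x)`, with `Φ` the distribution function of the standard
normal law. -/
def gelu (x : ℝ) : ℝ := x * ProbabilityTheory.cdf (ProbabilityTheory.gaussianReal 0 1) x

/-- Parameters `θ` of a dense feedforward network from `ℝ^n` to `ℝ^k`, listed from the input side:
any number of hidden layers of arbitrary widths, followed by an affine output layer. -/
inductive DenseNet : ℕ → ℕ → Type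
  | output {n k : ℕ} (W : Matrix (Fin k) (Fin n) ℝ) (b : Fin k → ℝ) : DenseNet n k
  | hidden {n w k : ℕ} (W : Matrix (Fin w) (Fin n) ℝ) (b : Fin w → ℝ) (rest : DenseNet w k) :
      DenseNet n k

/-- The number of hidden layers. -/
def DenseNet.depth : {n k : ℕ} → DenseNet n k → ℕ
  | _, _, .output _ _ => 0
  | _, _, .hidden _ _ rest => rest.depth + 1

/-- The map realized by a network with GELU activation: `a ↦ gelu (W a + b)`, componentwise, in each
hidden layer and `a ↦ W a + b` in the output layer. -/
def DenseNet.eval : {n k : ℕ} → DenseNet n k → (Fin n → ℝ) → (Fin k → ℝ)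
  | _, _, .output W b, a => W.mulVec a + b
  | _, _, .hidden W b rest, a => rest.eval (fun i => gelu ((W.mulVec a + b) i))

/-! ### Reduced bases -/

/-- The index set `{0, 1, …, N - 1}`, respectively `ℕ` if `N = ⊤`, of an orthonormal basis of a
separable Hilbert space of dimension `N`. -/
abbrev BasisIndex (N : ℕ∞) : Type := {i : ℕ // (i : ℕ∞) < N}

/-- The `i`-th basis index, for `i` below a rank `r` that does not exceed the dimension. -/
def basisIndex {N : ℕ∞} {r : ℕ} (hr : (r : ℕ∞) ≤ N) (i : Fin r) : BasisIndex N :=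
  ⟨i, lt_of_lt_of_le (Nat.cast_lt.mpr i.isLt) hr⟩

section Basis

variable {X : Type*} [NormedAddCommGroup X] [InnerProductSpace ℝ X]

/-- Encoding: the first `r` coefficients of `x` in the basis `e`. -/
def encode {N : ℕ∞} (e : HilbertBasis (BasisIndex N) ℝ X) {r : ℕ} (hr : (r : ℕ∞) ≤ N) (x : X) :
    Fin r → ℝ :=
  fun i => inner ℝ (e (basisIndex hr i)) x

/-- Decoding: the combination of the first `r` vectors of the basis `e` with coefficients `c`. -/
def decode {N : ℕ∞} (e : HilbertBasis (BasisIndex N) ℝ X) {r : ℕ} (hr : (r : ℕ∞) ≤ N)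
    (c : Fin r → ℝ) : X :=
  ∑ i, c i • e (basisIndex hr i)

end Basis

section Problem

variable {U M : Type*} [NormedAddCommGroup U] [InnerProductSpace ℝ U]
  [NormedAddCommGroup M] [InnerProductSpace ℝ M]
  {Z : Type*} [NormedAddCommGroup Z] [InnerProductSpace ℝ Z] {d : ℕ}

/-- The reduced-basis neural operator
`(m, z) ↦ ∑_{i < ru} g(⟨m - bm, ψ_0⟩, …, ⟨m - bm, ψ_{rm - 1}⟩, z)_i φ_i + bu`,
where `g` is a GELU network. -/
def rbno {NU NM : ℕ∞} (φ : HilbertBasis (BasisIndex NU) ℝ U)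
    (ψ : HilbertBasis (BasisIndex NM) ℝ M) (bu : U) (bm : M) {ru rm : ℕ}
    (hru : (ru : ℕ∞) ≤ NU) (hrm : (rm : ℕ∞) ≤ NM) (g : DenseNet (rm + d) ru)
    (m : M) (z : Design d) : U :=
  decode φ hru (g.eval (Fin.append (encode ψ hrm (m - bm)) (fun j => z j))) + bu

/-! ### The data of the optimization problem -/

/-- The Hilbert–Schmidt norm of an operator on `ℝ^d`, computed in the standard basis. -/
def hsNorm (A : Design d →L[ℝ] U) : ℝ :=
  Real.sqrt (∑ j, ‖A (EuclideanSpace.single j (1 : ℝ))‖ ^ 2)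

/-- The partial derivative `D_z u(m, z)`. -/
def Dz (u : M → Z → U) (m : M) (z : Z) : Z →L[ℝ] U :=
  fderiv ℝ (fun z' => u m z') z

/-- The regularity assumptions on the solution operator `u : M × B → U`. -/
structure SolutionAssumption (B : Set (Design d)) (u : M → Design d → U) : Prop where
  contDiff : ContDiffOn ℝ 1 (fun x : M × Design d => u x.1 x.2) {x | x.2 ∈ B}
  lipschitz : ∃ κ > 0, ∀ m₁ m₂ : M, ∀ z₁ ∈ B, ∀ z₂ ∈ B,
    ‖u m₂ z₂ - u m₁ z₁‖ ≤ κ * (‖m₂ - m₁‖ + ‖z₂ - z₁‖)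
  lipschitz_Dz : ∃ κ > 0, ∀ m₁ m₂ : M, ∀ z₁ ∈ B, ∀ z₂ ∈ B,
    hsNorm (Dz u m₂ z₂ - Dz u m₁ z₁) ≤ κ * (‖m₂ - m₁‖ + ‖z₂ - z₁‖)

/-- The partial derivative `D_u Q(v, m, z)`, an element of the dual of `U`. -/
def DuQ (Q : U → M → Z → ℝ) (v : U) (m : M) (z : Z) : U →L[ℝ] ℝ :=
  fderiv ℝ (fun v' => Q v' m z) v

/-- The partial derivative `D_z Q(v, m, z)`, an element of the dual of `Z`. -/
def DzQ (Q : U → M → Z → ℝ) (v : U) (m : M) (z : Z) : Z →L[ℝ] ℝ :=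
  fderiv ℝ (fun z' => Q v m z') z

/-- The mixed partial derivative `D_{uz} Q(v, m, z)`, a bounded operator from `U` to the dual of
`Z`. -/
def DuzQ (Q : U → M → Z → ℝ) (v : U) (m : M) (z : Z) :
    U →L[ℝ] (Z →L[ℝ] ℝ) :=
  fderiv ℝ (fun v' => DzQ Q v' m z) v

/-- The regularity assumptions on the quantity of interest `Q : U × M × B → ℝ`. -/
structure QoIAssumption (B : Set Z) (Q : U → M → Z → ℝ) : Prop where
  contDiff : ContDiffOn ℝ 2 (fun x : U × M × Z => Q x.1 x.2.1 x.2.2) {x | x.2.2 ∈ B}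
  lipschitz_DuQ : ∃ κ > 0, ∀ v₁ v₂ : U, ∀ m : M, ∀ z ∈ B,
    ‖DuQ Q v₂ m z - DuQ Q v₁ m z‖ ≤ κ * ‖v₂ - v₁‖
  lipschitz_DuzQ : ∃ κ > 0, ∀ v₁ v₂ : U, ∀ m : M, ∀ z ∈ B,
    ‖DuzQ Q v₂ m z - DuzQ Q v₁ m z‖ ≤ κ * ‖v₂ - v₁‖
  bound_Q : ∃ C ≥ 0, ∀ m : M, ∀ z ∈ B, |Q 0 m z| ≤ C
  bound_DuQ : ∃ C ≥ 0, ∀ m : M, ∀ z ∈ B, ‖DuQ Q 0 m z‖ ≤ C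
  bound_DzQ : ∃ C ≥ 0, ∀ m : M, ∀ z ∈ B, ‖DzQ Q 0 m z‖ ≤ C
  bound_DuzQ : ∃ C ≥ 0, ∀ m : M, ∀ z ∈ B, ‖DuzQ Q 0 m z‖ ≤ C

/-- The penalized mean objective `z ↦ E_{m ∼ μ}[Q(u(m, z), m, z)] + P(z)`. -/
def meanObjective [MeasurableSpace M] (μ : Measure M) (Q : U → M → Z → ℝ)
    (P : Z → ℝ) (u : M → Z → U) (z : Z) : ℝ :=
  (∫ m, Q (u m z) m z ∂μ) + P z

/-- Strong convexity, with some modulus `lam > 0`, of a differentiable function on an open set. -/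
def StronglyConvex (B : Set Z) (J : Z → ℝ) : Prop :=
  ∃ lam > 0, ∀ z₁ ∈ B, ∀ z₂ ∈ B,
    J z₁ + fderiv ℝ J z₁ (z₂ - z₁) + lam / 2 * ‖z₂ - z₁‖ ^ 2 ≤ J z₂

/-- `z` is a first-order stationary point of the minimization of `J` over `Zad`. -/
def IsStationary (Zad : Set Z) (J : Z → ℝ) (z : Z) : Prop :=
  z ∈ Zad ∧ DifferentiableAt ℝ J z ∧ ∀ z' ∈ Zad, 0 ≤ fderiv ℝ J z (z' - z)

end Problem

end

end RBNO

/-! The proof rests on the stability of minimizers of strongly convex functions. Suppose the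
gradients of `J_θ` and `J` differ by at most `η` on `Zad`. Adding quadratic growth at the minimizer
`zs` to strong convexity at a stationary point `zd`, and testing stationarity in the direction `zs -
zd`, gives `λ ‖zs - zd‖² ≤ η ‖zs - zd‖`. Hence the distance is at most `η / λ` and the gap at most
`η² / λ` (`stationary_close`), and it suffices to make the gradients uniformly close
(`exists_rbno_gradient_close`).

The penalty cancels in the difference of the gradients, which is the mean of a difference of
`totalDz`. The Lipschitz bounds on `D_u Q` and `D_uz Q` control the integrand by a constant times `1
+ ‖m‖` times the error of the operator and of its `z`-derivative (`norm_totalDz_sub_le`). So `u` has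
to be approximated, with its `z`-derivative, in a weighted mean, for which second moments suffice.

Universal approximation holds on compact sets only, while `μ` may have unbounded support. The remedy
is a smooth truncation made of two activations, applied to each reduced coefficient. It sends every
parameter into one compact cube, so the network has no tail to control. Replacing `m` by its
truncation costs, by the Lipschitz bounds in `m`, a multiple of the displacement, whose weighted
mean tends to zero by dominated convergence (`exists_integral_truncError_le`). On the cube the
reduced solution map is a `C¹` function of finitely many variables, which decoded networks
approximate in `C¹` (`exists_isGeluNet_decode_close`). The truncation is absorbed exactly into the
network (`exists_rbno_eq_surrogate`).

The `C¹` approximation theorem has two parts. Convolution with Landau kernels yields polynomials,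
and differentiates under the integral, so polynomials are `C¹`-dense. Networks reach polynomials
because `gelu''(0) ≠ 0`: scaled second differences at `0` approximate the square, and polarization
gives products. The identity `gelu x - gelu (-x) = x` lets values pass unchanged through hidden
layers. -/

namespace RBNO

/-! ### The Gaussian error linear unit -/

section Gelu

open ProbabilityTheory Filter Topology

/-- The density of the standard normal law. -/
noncomputable abbrev stdPDF (x : ℝ) : ℝ := gaussianPDFReal 0 1 x

/-- The distribution function of the standard normal law. -/
noncomputable abbrev stdCDF (x : ℝ) : ℝ := cdf (gaussianReal 0 1) x

lemma stdPDF_eq (x : ℝ) : stdPDF x = (√(2 * Real.pi))⁻¹ * Real.exp (-x ^ 2 / 2) := by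
  simp [stdPDF, gaussianPDFReal]

lemma contDiff_stdPDF : ContDiff ℝ 1 stdPDF := by
  have : stdPDF = fun x => (√(2 * Real.pi))⁻¹ * Real.exp (-x ^ 2 / 2) := funext stdPDF_eq
  rw [this]; fun_prop

lemma stdPDF_zero_pos : 0 < stdPDF 0 := gaussianPDFReal_pos _ _ _ one_ne_zero

lemma stdCDF_eq_integral (x : ℝ) : stdCDF x = ∫ y in Set.Iic x, stdPDF y := by
  rw [stdCDF, cdf_eq_real, Measure.real, gaussianReal_apply_eq_integral _ one_ne_zero,
    ENNReal.toReal_ofReal]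
  exact setIntegral_nonneg measurableSet_Iic fun y _ => gaussianPDFReal_nonneg _ _ _

lemma hasDerivAt_stdCDF (x : ℝ) : HasDerivAt stdCDF (stdPDF x) x := by
  have h : stdCDF = fun x => (∫ y in (0 : ℝ)..x, stdPDF y) + stdCDF 0 := by
    funext x
    rw [stdCDF_eq_integral, stdCDF_eq_integral 0, ← intervalIntegral.integral_Iic_sub_Iic
      (integrable_gaussianPDFReal 0 1).integrableOn (integrable_gaussianPDFReal 0 1).integrableOn]
    ring
  rw [h]
  refine HasDerivAt.add_const _ ?_
  exact intervalIntegral.integral_hasDerivAt_right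
    (integrable_gaussianPDFReal 0 1).intervalIntegrable
    (contDiff_stdPDF.continuous.stronglyMeasurableAtFilter _ _)
    contDiff_stdPDF.continuous.continuousAt

lemma stdCDF_neg (x : ℝ) : stdCDF (-x) = 1 - stdCDF x := by
  have h1 : (gaussianReal 0 1).real (Set.Iic (-x)) = (gaussianReal 0 1).real (Set.Ici x) := by
    have : (gaussianReal 0 1).map (fun x => -x) = gaussianReal 0 1 := by
      rw [gaussianReal_map_neg]; simp
    conv_lhs => rw [← this]
    rw [Measure.real, Measure.map_apply (by fun_prop) measurableSet_Iic]
    congr 2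
    ext y; simp
  rw [stdCDF, stdCDF, cdf_eq_real, cdf_eq_real, h1]
  have : NullSingletonClass (gaussianReal 0 1) := nullSingletonClass_gaussianReal one_ne_zero
  have h2 := measureReal_compl (μ := gaussianReal 0 1) (s := Set.Iic x) measurableSet_Iic
  rw [Set.compl_Iic, probReal_univ] at h2
  rw [← h2]
  exact measureReal_congr Ioi_ae_eq_Ici.symm

lemma gelu_eq (x : ℝ) : gelu x = x * stdCDF x := rfl

/-- The identity is a difference of two activations. -/
lemma gelu_sub_gelu_neg (x : ℝ) : gelu x - gelu (-x) = x := by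
  rw [gelu_eq, gelu_eq, stdCDF_neg]; ring

/-- The derivative of the Gaussian error linear unit. -/
noncomputable def geluDeriv (x : ℝ) : ℝ := stdCDF x + x * stdPDF x

lemma hasDerivAt_gelu (x : ℝ) : HasDerivAt gelu (geluDeriv x) x := by
  have := (hasDerivAt_id x).mul (hasDerivAt_stdCDF x)
  simp only [id, one_mul] at this
  exact this

/-- The nonzero curvature at the origin is what lets networks produce squares. -/
lemma hasDerivAt_geluDeriv_zero : HasDerivAt geluDeriv (2 * stdPDF 0) 0 := by
  have h := (hasDerivAt_stdCDF 0).add ((hasDerivAt_id (0 : ℝ)).mul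
    ((contDiff_stdPDF.differentiable one_ne_zero) 0).hasDerivAt)
  have e : stdPDF 0 + (1 * stdPDF 0 + id 0 * deriv stdPDF 0) = 2 * stdPDF 0 := by
    rw [id, zero_mul]; ring
  rw [e] at h
  exact h

lemma continuous_stdCDF : Continuous stdCDF :=
  continuous_iff_continuousAt.2 fun x => (hasDerivAt_stdCDF x).continuousAt

lemma continuous_geluDeriv : Continuous geluDeriv :=
  continuous_stdCDF.add (continuous_id.mul contDiff_stdPDF.continuous)

lemma contDiff_gelu : ContDiff ℝ 1 gelu := by
  rw [contDiff_one_iff_deriv]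
  refine ⟨fun x => (hasDerivAt_gelu x).differentiableAt, ?_⟩
  have : deriv gelu = geluDeriv := funext fun x => (hasDerivAt_gelu x).deriv
  rw [this]; exact continuous_geluDeriv

lemma abs_geluDeriv_le (x : ℝ) : |geluDeriv x| ≤ 2 := by
  have h1 : |stdCDF x| ≤ 1 := by
    rw [abs_of_nonneg (cdf_nonneg _ _)]; exact cdf_le_one _ _
  have h2 : |x * stdPDF x| ≤ 1 := by
    rw [stdPDF_eq, abs_mul, abs_mul, abs_of_pos (Real.exp_pos _)]
    have h3 : (1 : ℝ) ≤ √(2 * Real.pi) := by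
      rw [Real.one_le_sqrt]; linarith [Real.pi_gt_three]
    have h4 : |(√(2 * Real.pi))⁻¹| ≤ 1 := by
      rw [abs_of_nonneg (by positivity)]; exact inv_le_one_of_one_le₀ h3
    have h5 : |x| * Real.exp (-x ^ 2 / 2) ≤ 1 := by
      have h6 : |x| ≤ Real.exp (x ^ 2 / 2) := by
        have := Real.add_one_le_exp (x ^ 2 / 2)
        nlinarith [sq_nonneg (|x| - 1), sq_abs x]
      have h7 : Real.exp (-x ^ 2 / 2) = (Real.exp (x ^ 2 / 2))⁻¹ := by
        rw [← Real.exp_neg]; ring_nf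
      rw [h7]
      exact mul_inv_le_one_of_le₀ h6 (Real.exp_pos _).le
    calc |x| * (|(√(2 * Real.pi))⁻¹| * Real.exp (-x ^ 2 / 2))
        = |(√(2 * Real.pi))⁻¹| * (|x| * Real.exp (-x ^ 2 / 2)) := by ring
      _ ≤ 1 * 1 := by gcongr
      _ = 1 := by ring
  calc |geluDeriv x| ≤ |stdCDF x| + |x * stdPDF x| := abs_add_le _ _
    _ ≤ 2 := by linarith

lemma abs_gelu_sub_le (x y : ℝ) : |gelu x - gelu y| ≤ 2 * |x - y| := by
  have := Convex.norm_image_sub_le_of_norm_hasDerivWithin_le (f := gelu) (f' := geluDeriv)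
    (s := Set.univ) (C := 2) (x := y) (y := x)
    (fun z _ => (hasDerivAt_gelu z).hasDerivWithinAt) (fun z _ => abs_geluDeriv_le z)
    convex_univ trivial trivial
  simpa using this

/-- Chebyshev's inequality for a variable of variance one bounds the tail by `1 / t ^ 2`, which
beats the factor `t`. -/
lemma abs_gelu_neg_le {t : ℝ} (ht : 0 < t) : |gelu (-t)| ≤ 1 / t := by
  have h1 : stdCDF (-t) ≤ 1 / t ^ 2 := by
    have hc := meas_ge_le_variance_div_sq (μ := gaussianReal 0 1) (X := id)
      (by simpa using memLp_id_gaussianReal (μ := 0) (v := 1) 2) ht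
    rw [variance_id_gaussianReal] at hc
    simp only [id, integral_id_gaussianReal, sub_zero, NNReal.coe_one] at hc
    rw [stdCDF, cdf_eq_real, Measure.real]
    refine ENNReal.toReal_le_of_le_ofReal (by positivity) (le_trans (measure_mono ?_) hc)
    intro y hy
    simp only [Set.mem_Iic, Set.mem_ofPred_eq] at hy ⊢
    rw [le_abs]; right; linarith
  rw [gelu_eq, abs_mul, abs_neg, abs_of_pos ht, abs_of_nonneg (cdf_nonneg _ _)]
  calc t * stdCDF (-t) ≤ t * (1 / t ^ 2) := by gcongr
    _ = 1 / t := by field_simp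

lemma abs_gelu_neg_le_one {t : ℝ} (ht : 0 ≤ t) : |gelu (-t)| ≤ 2 := by
  rcases le_or_gt t 1 with h | h
  · have h0 : gelu 0 = 0 := by simp [gelu_eq]
    have := abs_gelu_sub_le (-t) 0
    rw [h0, sub_zero, sub_zero, abs_neg, abs_of_nonneg ht] at this
    linarith
  · have := abs_gelu_neg_le (by linarith : 0 < t)
    have h2 : 1 / t ≤ 1 := by rw [div_le_one (by linarith)]; exact h.le
    linarith

lemma tendsto_gelu_atBot : Tendsto gelu atBot (𝓝 0) := by
  have h : Tendsto (fun t : ℝ => gelu (-t)) atTop (𝓝 0) := by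
    refine squeeze_zero_norm' (a := fun t => 1 / t) ?_ ?_
    · filter_upwards [eventually_gt_atTop 0] with t ht using abs_gelu_neg_le ht
    · simpa using tendsto_inv_atTop_zero (𝕜 := ℝ)
  simpa [Function.comp_def] using h.comp tendsto_neg_atBot_atTop

/-- A smooth truncation at height `R` built from two activations. -/
noncomputable def trunc (R x : ℝ) : ℝ := gelu (x + R) - gelu (x - R) - R

lemma trunc_zero (R : ℝ) : trunc R 0 = 0 := by
  have := gelu_sub_gelu_neg R
  simp only [trunc, zero_add, zero_sub]; linarith

lemma contDiff_trunc (R : ℝ) : ContDiff ℝ 1 (trunc R) := by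
  unfold trunc
  exact ((contDiff_gelu.comp (by fun_prop)).sub (contDiff_gelu.comp (by fun_prop))).sub
    contDiff_const

/-- Two 2-Lipschitz activations and the identity, all compared with their values at `0`, give 2 + 2
+ 1. The constant is independent of `R`, as dominated convergence for `R → ∞` requires. -/
lemma abs_trunc_sub_self_le (R x : ℝ) : |trunc R x - x| ≤ 5 * |x| := by
  have h0 := trunc_zero R
  have h1 := abs_gelu_sub_le (x + R) (0 + R)
  have h2 := abs_gelu_sub_le (x - R) (0 - R)
  have e1 : x + R - (0 + R) = x := by ring
  have e2 : x - R - (0 - R) = x := by ring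
  rw [e1] at h1; rw [e2] at h2
  have h3 : trunc R x - x
      = (gelu (x + R) - gelu (0 + R)) - (gelu (x - R) - gelu (0 - R)) - x := by
    simp only [trunc] at *; linarith
  rw [h3]
  have := abs_sub (gelu (x + R) - gelu (0 + R) - (gelu (x - R) - gelu (0 - R))) x
  have := abs_sub (gelu (x + R) - gelu (0 + R)) (gelu (x - R) - gelu (0 - R))
  linarith

/-- In this form both activations have arguments tending to `-∞` with `R`. -/
lemma trunc_sub_self (R x : ℝ) : trunc R x - x = gelu (-(x + R)) - gelu (x - R) := by
  have := gelu_sub_gelu_neg (x + R)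
  simp only [trunc]; linarith

lemma tendsto_trunc (x : ℝ) : Tendsto (fun R => trunc R x) atTop (𝓝 x) := by
  have h1 : Tendsto (fun R => gelu (-(x + R))) atTop (𝓝 0) :=
    tendsto_gelu_atBot.comp (tendsto_neg_atTop_atBot.comp (tendsto_atTop_add_const_left _ _
      tendsto_id))
  have h2 : Tendsto (fun R => gelu (x - R)) atTop (𝓝 0) :=
    tendsto_gelu_atBot.comp (tendsto_atBot_add_const_left _ x tendsto_neg_atTop_atBot)
  have h3 := (h1.sub h2).add_const x
  simp only [sub_zero, zero_add] at h3
  refine h3.congr fun R => ?_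
  rw [← trunc_sub_self]; ring

/-- The activation stays within 2 of the positive part, so `trunc R` stays within 4 of the clipping
to `[-R, R]`. -/
lemma abs_trunc_le {R : ℝ} (hR : 0 ≤ R) (x : ℝ) : |trunc R x| ≤ R + 4 := by
  have key : ∀ t : ℝ, |gelu t - max t 0| ≤ 2 := by
    intro t
    rcases le_total t 0 with h | h
    · rw [max_eq_right h, sub_zero]
      simpa using abs_gelu_neg_le_one (neg_nonneg.2 h)
    · rw [max_eq_left h]
      have := gelu_sub_gelu_neg t
      have h2 := abs_gelu_neg_le_one h
      rwa [show gelu t - t = gelu (-t) by linarith]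
  have h1 := abs_le.1 (key (x + R))
  have h2 := abs_le.1 (key (x - R))
  have h3 : |max (x + R) 0 - max (x - R) 0 - R| ≤ R := by
    rw [abs_le]
    rcases le_total (x + R) 0 with h | h <;> rcases le_total (x - R) 0 with h' | h' <;>
      simp only [max_eq_left, max_eq_right, h, h'] <;> constructor <;> linarith
  have h3 := abs_le.1 h3
  rw [trunc, abs_le]
  constructor <;> linarith

end Gelu

/-! ### The calculus of GELU networks -/

section Networks

/-- Maps realized by GELU networks between coordinate spaces with arbitrary finite index types. -/
inductive IsGeluNet : {ι κ : Type} → ((ι → ℝ) → (κ → ℝ)) → Prop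
  | affine {ι κ : Type} [Fintype ι] [Fintype κ] (A : (ι → ℝ) →ₗ[ℝ] (κ → ℝ)) (b : κ → ℝ) :
      IsGeluNet fun x => A x + b
  | layer {ι w κ : Type} [Fintype ι] [Fintype w] (A : (ι → ℝ) →ₗ[ℝ] (w → ℝ))
      (b : w → ℝ) {f : (w → ℝ) → (κ → ℝ)} (hf : IsGeluNet f) :
      IsGeluNet fun x => f fun i => gelu ((A x + b) i)

namespace IsGeluNet

variable {ι κ w l : Type}

lemma comp_affine [Fintype ι] {g : (w → ℝ) → (κ → ℝ)} (hg : IsGeluNet g) (A : (ι → ℝ) →ₗ[ℝ] (w → ℝ))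
    (b : w → ℝ) : IsGeluNet fun x => g (A x + b) := by
  cases hg with
  | affine A' b' =>
    have := affine (A' ∘ₗ A) (A' b + b')
    convert this using 2 with x
    simp [add_assoc]
  | layer A' b' hf =>
    have := layer (A' ∘ₗ A) (A' b + b') hf
    convert this using 5 with x i
    simp [add_assoc]

lemma comp {f : (ι → ℝ) → (w → ℝ)} {g : (w → ℝ) → (κ → ℝ)} (hg : IsGeluNet g)
    (hf : IsGeluNet f) : IsGeluNet fun x => g (f x) := by
  induction hf with
  | affine A b => exact hg.comp_affine A b
  | layer A b hf ih => exact layer A b (ih hg)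

lemma of_linear [Fintype ι] [Fintype κ] (A : (ι → ℝ) →ₗ[ℝ] (κ → ℝ)) : IsGeluNet fun x => A x := by
  simpa using affine A 0

lemma reindex [Fintype ι] [Fintype κ] (e : κ → ι) : IsGeluNet fun (x : ι → ℝ) => fun i => x (e i) :=
  of_linear (LinearMap.funLeft ℝ ℝ e)

lemma activation [Fintype ι] : IsGeluNet fun (x : ι → ℝ) => fun i => gelu (x i) := by
  have := layer (LinearMap.id : (ι → ℝ) →ₗ[ℝ] (ι → ℝ)) 0 (of_linear LinearMap.id)
  simpa using this

/-- A network can be run in parallel with the identity. -/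
lemma sumId [Fintype l] {f : (ι → ℝ) → (κ → ℝ)} (hf : IsGeluNet f) :
    IsGeluNet fun (x : ι ⊕ l → ℝ) =>
      (Sum.elim (f fun i => x (.inl i)) (fun j => x (.inr j)) : κ ⊕ l → ℝ) := by
  induction hf with
  | @affine ι κ _ _ A b =>
    let A' : (ι ⊕ l → ℝ) →ₗ[ℝ] (κ ⊕ l → ℝ) :=
      { toFun := fun x => Sum.elim (A fun i => x (.inl i)) (fun j => x (.inr j))
        map_add' := fun x y => by
          ext (i | i)
          · exact congrFun (A.map_add (fun i => x (.inl i)) (fun i => y (.inl i))) i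
          · rfl
        map_smul' := fun c x => by
          ext (i | i)
          · exact congrFun (A.map_smul c (fun i => x (.inl i))) i
          · rfl }
    have := affine A' (Sum.elim b 0)
    convert this using 2 with x
    ext (i | i) <;> simp [A']
  | @layer ι w κ _ _ A b f hf ih =>
    -- Each carried coordinate enters the activation as the pair `x`, `-x`; `S` recovers it as a
    -- difference.
    let A' : (ι ⊕ l → ℝ) →ₗ[ℝ] (w ⊕ (l ⊕ l) → ℝ) :=
      { toFun := fun x => Sum.elim (A fun i => x (.inl i))
          (Sum.elim (fun j => x (.inr j)) (fun j => - x (.inr j)))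
        map_add' := fun x y => by
          ext (i | i | i)
          · exact congrFun (A.map_add (fun i => x (.inl i)) (fun i => y (.inl i))) i
          · rfl
          · simp [add_comm]
        map_smul' := fun c x => by
          ext (i | i | i)
          · exact congrFun (A.map_smul c (fun i => x (.inl i))) i
          · rfl
          · simp }
    let S : (w ⊕ (l ⊕ l) → ℝ) →ₗ[ℝ] (w ⊕ l → ℝ) :=
      { toFun := fun x => Sum.elim (fun i => x (.inl i))
          (fun j => x (.inr (.inl j)) - x (.inr (.inr j)))
        map_add' := fun x y => by
          ext (i | i)
          · rfl
          · simp; ring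
        map_smul' := fun c x => by
          ext (i | i)
          · rfl
          · simp; ring }
    have := layer A' (Sum.elim b 0) (ih.comp (of_linear S))
    convert this using 2 with x
    ext (i | i)
    · simp [S, A']
    · simp [S, A', gelu_sub_gelu_neg]

/-- Two networks with the same input can be run in parallel. -/
lemma pair [Fintype ι] [Fintype κ] [Fintype w] {f : (ι → ℝ) → (κ → ℝ)}
    {g : (ι → ℝ) → (w → ℝ)} (hf : IsGeluNet f)
    (hg : IsGeluNet g) : IsGeluNet fun x => (Sum.elim (f x) (g x) : κ ⊕ w → ℝ) := by
  -- The networks may differ in depth, so they run one after the other: `f` while the input is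
  -- carried along, then `g` while the output of `f` is carried along.
  have h1 : IsGeluNet fun (x : ι → ℝ) => (Sum.elim (f x) x : κ ⊕ ι → ℝ) := by
    have := (hf.sumId (l := ι)).comp (reindex (Sum.elim id id : ι ⊕ ι → ι))
    exact this
  have h2 := (hg.sumId (l := κ)).comp ((reindex (Sum.swap : ι ⊕ κ → κ ⊕ ι)).comp h1)
  have h3 := (reindex (Sum.swap : κ ⊕ w → w ⊕ κ)).comp h2
  convert h3 using 2 with x
  ext (i | i) <;> simp

lemma append {n : ℕ} {k r : ℕ} {f : (Fin n → ℝ) → (Fin k → ℝ)} {g : (Fin n → ℝ) → (Fin r → ℝ)}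
    (hf : IsGeluNet f) (hg : IsGeluNet g) : IsGeluNet fun x => Fin.append (f x) (g x) := by
  have := (reindex (finSumFinEquiv.symm : Fin (k + r) → Fin k ⊕ Fin r)).comp (hf.pair hg)
  convert this using 2 with x
  ext i
  refine Fin.addCases (fun i => ?_) (fun i => ?_) i <;> simp

/-- Finitely many scalar networks are the components of one network. -/
lemma pi [Fintype ι] {k : ℕ} {f : Fin k → (ι → ℝ) → ℝ}
    (hf : ∀ i, IsGeluNet fun x => fun _ : Unit => f i x) :
    IsGeluNet fun x => fun i => f i x := by
  induction k with
  | zero =>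
    convert of_linear (0 : (ι → ℝ) →ₗ[ℝ] (Fin 0 → ℝ)) using 2 with x
  | succ k ih =>
    have h := (hf 0).pair (ih fun i => hf i.succ)
    have h2 := (reindex (Fin.cases (.inl ()) .inr : Fin (k + 1) → Unit ⊕ Fin k)).comp h
    convert h2 using 2 with x
    ext i
    refine Fin.cases ?_ (fun i => ?_) i <;> rfl

/-- The calculus above uses sums of index types. The equivalences with `Fin` are quantified inside
the statement so that the induction can choose an enumeration of each hidden width. -/
lemma exists_denseNet {f : (ι → ℝ) → (κ → ℝ)} (hf : IsGeluNet f) :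
    ∀ {n k : ℕ} (e : ι ≃ Fin n) (e' : κ ≃ Fin k),
      ∃ g : DenseNet n k, ∀ x, g.eval x = fun j => f (fun i => x (e i)) (e'.symm j) := by
  induction hf with
  | affine A b =>
    intro n k e e'
    refine ⟨.output (LinearMap.toMatrix' (LinearMap.funLeft ℝ ℝ e'.symm ∘ₗ A ∘ₗ
      LinearMap.funLeft ℝ ℝ e)) (fun j => b (e'.symm j)), fun x => ?_⟩
    rw [DenseNet.eval, LinearMap.toMatrix'_mulVec]
    rfl
  | @layer ι w κ _ _ A b f hf ih =>
    intro n k e e'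
    obtain ⟨g, hg⟩ := ih (Fintype.equivFin w) e'
    refine ⟨.hidden (LinearMap.toMatrix' (LinearMap.funLeft ℝ ℝ (Fintype.equivFin w).symm ∘ₗ A ∘ₗ
      LinearMap.funLeft ℝ ℝ e)) (fun j => b ((Fintype.equivFin w).symm j)) g, fun x => ?_⟩
    rw [DenseNet.eval, LinearMap.toMatrix'_mulVec, hg]
    funext j
    congr 1
    funext i
    simp only [LinearMap.coe_comp, Function.comp_apply, LinearMap.funLeft_apply, Pi.add_apply,
      Equiv.symm_apply_apply]
    rfl

/-- A network map is realized by a network with at least one hidden layer. -/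
lemma exists_denseNet_depth {n k : ℕ} {f : (Fin n → ℝ) → (Fin k → ℝ)} (hf : IsGeluNet f) :
    ∃ g : DenseNet n k, 1 ≤ g.depth ∧ ∀ x, g.eval x = f x := by
  -- A hidden layer realizing the identity is prepended, so that the depth is positive even for
  -- affine `f`.
  let A : (Fin n → ℝ) →ₗ[ℝ] (Fin n ⊕ Fin n → ℝ) :=
    { toFun := fun x => Sum.elim x (-x)
      map_add' := fun x y => by ext (i | i) <;> simp [add_comm]
      map_smul' := fun c x => by ext (i | i) <;> simp }
  let S : (Fin n ⊕ Fin n → ℝ) →ₗ[ℝ] (Fin n → ℝ) :=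
    LinearMap.funLeft ℝ ℝ Sum.inl - LinearMap.funLeft ℝ ℝ Sum.inr
  obtain ⟨g, hg⟩ := (hf.comp (of_linear S)).exists_denseNet finSumFinEquiv (Equiv.refl _)
  refine ⟨.hidden (LinearMap.toMatrix' (LinearMap.funLeft ℝ ℝ finSumFinEquiv.symm ∘ₗ A)) 0 g,
    by simp [DenseNet.depth], fun x => ?_⟩
  rw [DenseNet.eval, LinearMap.toMatrix'_mulVec, hg]
  funext j
  congr 1
  funext i
  simp [S, A, LinearMap.funLeft, gelu_sub_gelu_neg]

lemma contDiff {f : (ι → ℝ) → (κ → ℝ)} (hf : IsGeluNet f) :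
    ∀ [Fintype ι] [Fintype κ], ContDiff ℝ 1 f := by
  induction hf with
  | affine A b =>
    intro _ _
    exact (LinearMap.toContinuousLinearMap A).contDiff.add contDiff_const
  | layer A b hf ih =>
    intro _ _
    refine ih.comp (contDiff_pi.2 fun i => contDiff_gelu.comp ?_)
    exact contDiff_pi.1 ((LinearMap.toContinuousLinearMap A).contDiff.add contDiff_const) i

end IsGeluNet

/-- Real-valued functions realized by a GELU network. -/
def IsScalarNet {ι : Type} (f : (ι → ℝ) → ℝ) : Prop := IsGeluNet fun x => fun _ : Unit => f x

namespace IsScalarNet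

variable {ι : Type} [Fintype ι] {f g : (ι → ℝ) → ℝ}

lemma contDiff (hf : IsScalarNet f) : ContDiff ℝ 1 f := contDiff_pi.1 (IsGeluNet.contDiff hf) ()

lemma coord (i : ι) : IsScalarNet fun x => x i := IsGeluNet.reindex fun _ : Unit => i

lemma const (c : ℝ) : IsScalarNet fun _ : ι → ℝ => c := by
  have := IsGeluNet.affine (0 : (ι → ℝ) →ₗ[ℝ] (Unit → ℝ)) (fun _ => c)
  rw [IsScalarNet]
  simpa using this

lemma linear_comb (hf : IsScalarNet f) (hg : IsScalarNet g) (a b : ℝ) :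
    IsScalarNet fun x => a * f x + b * g x := by
  have := (IsGeluNet.of_linear (a • LinearMap.funLeft ℝ ℝ (fun _ : Unit => .inl ()) +
    b • LinearMap.funLeft ℝ ℝ (fun _ : Unit => .inr ()) :
      (Unit ⊕ Unit → ℝ) →ₗ[ℝ] (Unit → ℝ))).comp (IsGeluNet.pair hf hg)
  exact this

lemma add (hf : IsScalarNet f) (hg : IsScalarNet g) : IsScalarNet fun x => f x + g x := by
  simpa using hf.linear_comb hg 1 1

lemma const_mul (hf : IsScalarNet f) (a : ℝ) : IsScalarNet fun x => a * f x := by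
  simpa using hf.linear_comb hf a 0

lemma sub (hf : IsScalarNet f) (hg : IsScalarNet g) : IsScalarNet fun x => f x - g x := by
  simpa [sub_eq_add_neg] using hf.linear_comb hg 1 (-1)

omit [Fintype ι] in
lemma gelu_comp (hf : IsScalarNet f) : IsScalarNet fun x => gelu (f x) :=
  IsGeluNet.comp (IsGeluNet.activation (ι := Unit)) hf

lemma trunc_comp (hf : IsScalarNet f) (R : ℝ) : IsScalarNet fun x => trunc R (f x) :=
  ((hf.add (const R)).gelu_comp.sub (hf.sub (const R)).gelu_comp).sub (const R)

end IsScalarNet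

end Networks

/-! ### Polynomial approximation of continuously differentiable functions -/

section Weierstrass

open Filter Topology

variable {n : ℕ}

/-- The generator of the Landau kernels. -/
def landau (a : ℝ) (s : Fin n → ℝ) : ℝ := 1 - a * ∑ i, s i ^ 2

lemma continuous_landau (a : ℝ) : Continuous (landau a : (Fin n → ℝ) → ℝ) := by
  unfold landau; fun_prop

lemma landau_nonneg {a ρ : ℝ} (ha : 0 ≤ a) (haρ : a * (n * ρ ^ 2) ≤ 1) {s : Fin n → ℝ}
    (hs : s ∈ Metric.closedBall (0 : Fin n → ℝ) ρ) : 0 ≤ landau a s := by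
  have h : ∑ i, s i ^ 2 ≤ n * ρ ^ 2 := by
    calc ∑ i, s i ^ 2 ≤ ∑ _i : Fin n, ρ ^ 2 := by
          refine Finset.sum_le_sum fun i _ => ?_
          rw [← sq_abs]
          have : |s i| ≤ ρ := (norm_le_pi_norm s i).trans (by simpa using hs)
          gcongr
      _ = n * ρ ^ 2 := by simp
  have := mul_le_mul_of_nonneg_left h ha
  unfold landau; linarith

/-- The total mass of the `k`-th Landau kernel on a cube. -/
noncomputable def landauMass (n : ℕ) (a ρ : ℝ) (k : ℕ) : ℝ :=
  ∫ s in Metric.closedBall (0 : Fin n → ℝ) ρ, landau a s ^ k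

/-- On the cube the kernel is nonnegative with unique maximum at `0`, so its normalized powers
concentrate there. -/
lemma tendsto_landau {a ρ : ℝ} (ha : 0 < a) (hρ : 0 < ρ) (haρ : a * (n * ρ ^ 2) ≤ 1)
    {g : (Fin n → ℝ) → ℝ} (hg : Continuous g) :
    Tendsto (fun k => (landauMass n a ρ k)⁻¹ *
      ∫ s in Metric.closedBall (0 : Fin n → ℝ) ρ, landau a s ^ k * g s) atTop (𝓝 (g 0)) := by
  have := tendsto_setIntegral_pow_smul_of_unique_maximum_of_isCompact_of_continuousOn
    (μ := volume) (s := Metric.closedBall (0 : Fin n → ℝ) ρ) (c := landau a) (x₀ := 0) (g := g)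
    (isCompact_closedBall _ _) (continuous_landau a).continuousOn ?_
    (fun s hs => landau_nonneg ha.le haρ hs) (by simp [landau]) ?_ hg.continuousOn
  · exact this
  · intro y _ hy
    obtain ⟨i, hi⟩ := Function.ne_iff.1 hy
    have h1 : 0 < ∑ i, y i ^ 2 := by
      refine Finset.sum_pos' (fun i _ => sq_nonneg _) ⟨i, Finset.mem_univ _, ?_⟩
      exact sq_pos_of_ne_zero hi
    have : 0 < a * ∑ i, y i ^ 2 := mul_pos ha h1
    simp only [landau, Pi.zero_apply]
    simp
    exact this
  · rw [interior_closedBall _ hρ.ne']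
    exact subset_closure (by simpa using hρ)

/-- By `hK`, only differences `x - t` in the cube contribute, where the kernel is nonnegative; hence
the polynomial kernel needs no cutoff. Values in a general `V` allow the same estimate for `f` and
for its derivative. -/
lemma landau_convolution_close {V : Type*} [NormedAddCommGroup V] [NormedSpace ℝ V]
    [CompleteSpace V] {a ρ : ℝ} (ha : 0 < a) (hρ : 0 < ρ) (haρ : a * (n * ρ ^ 2) ≤ 1)
    {F : (Fin n → ℝ) → V} (hF : Continuous F) (hFc : HasCompactSupport F)
    {K : Set (Fin n → ℝ)} (hK : ∀ x ∈ K, ∀ t, F t ≠ 0 → ‖x - t‖ ≤ ρ) {ε : ℝ} (hε : 0 < ε) :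
    ∀ᶠ k in atTop, ∀ x ∈ K,
      ‖(∫ t, ((landauMass n a ρ k)⁻¹ * landau a (x - t) ^ k) • F t) - F x‖ ≤ ε := by
  obtain ⟨M, hM⟩ : ∃ M, ∀ x, ‖F x‖ ≤ M := hFc.exists_bound_of_continuous hF
  have hM0 : 0 ≤ M := (norm_nonneg _).trans (hM 0)
  obtain ⟨δ, hδ, hδF⟩ := Metric.uniformContinuous_iff.1
    (hFc.uniformContinuous_of_continuous hF) (ε / 2) (by positivity)
  set C := 2 * M / δ
  have hC : 0 ≤ C := by positivity
  -- A modulus of continuity that is continuous in `s` and free of `x`: concentration is then needed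
  -- for one test function only, and the estimate is uniform in `x`.
  have hmod : ∀ x s, ‖F (x - s) - F x‖ ≤ ε / 2 + C * ‖s‖ := by
    intro x s
    rcases lt_or_ge ‖s‖ δ with h | h
    · have := hδF (a := x - s) (b := x) (by simpa [dist_eq_norm] using h)
      rw [dist_eq_norm] at this
      have : 0 ≤ C * ‖s‖ := by positivity
      linarith
    · have h1 : 2 * M ≤ C * ‖s‖ := by
        calc 2 * M = C * δ := by simp only [C]; field_simp
          _ ≤ C * ‖s‖ := by gcongr
      have := norm_sub_le (F (x - s)) (F x)
      linarith [hM (x - s), hM x]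
  have h1 := tendsto_landau ha hρ haρ (g := fun _ => 1) continuous_const
  have h2 := tendsto_landau ha hρ haρ (g := fun s => ε / 2 + C * ‖s‖) (by fun_prop)
  simp only [mul_one, norm_zero, mul_zero, add_zero] at h1 h2
  filter_upwards [h1.eventually (lt_mem_nhds (show (0 : ℝ) < 1 by norm_num)),
    h2.eventually (gt_mem_nhds (show ε / 2 < ε by linarith))] with k hk1 hk2 x hx
  set I := landauMass n a ρ k with hI
  set D := Metric.closedBall (0 : Fin n → ℝ) ρ with hD
  have hD_compact : IsCompact D := isCompact_closedBall _ _
  have hI0 : I ≠ 0 := by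
    rintro h0
    rw [h0] at hk1; simp at hk1
  have hInn : 0 ≤ I := setIntegral_nonneg hD_compact.measurableSet
    fun s hs => pow_nonneg (landau_nonneg ha.le haρ hs) _
  have e1 : (∫ t, (I⁻¹ * landau a (x - t) ^ k) • F t) =
      ∫ s in D, (I⁻¹ * landau a s ^ k) • F (x - s) := by
    rw [← integral_sub_left_eq_self _ volume x]
    simp only [sub_sub_cancel]
    refine (setIntegral_eq_integral_of_forall_compl_eq_zero fun s hs => ?_).symm
    by_contra h
    refine hs ?_
    have := hK x hx (x - s) fun h0 => h (by rw [h0, smul_zero])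
    simpa [hD] using this
  have e2 : F x = ∫ s in D, (I⁻¹ * landau a s ^ k) • F x := by
    rw [integral_smul_const, integral_const_mul]
    change F x = (I⁻¹ * I) • F x
    rw [inv_mul_cancel₀ hI0, one_smul]
  have hc : Continuous fun s : Fin n → ℝ => I⁻¹ * landau a s ^ k :=
    continuous_const.mul ((continuous_landau a).pow k)
  have i1 : IntegrableOn (fun s => (I⁻¹ * landau a s ^ k) • F (x - s)) D :=
    (hc.smul (hF.comp (by fun_prop))).continuousOn.integrableOn_compact hD_compact
  have i2 : IntegrableOn (fun s => (I⁻¹ * landau a s ^ k) • F x) D :=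
    (hc.smul continuous_const).continuousOn.integrableOn_compact hD_compact
  have e3 : (∫ s in D, (I⁻¹ * landau a s ^ k) • F (x - s)) - F x =
      ∫ s in D, (I⁻¹ * landau a s ^ k) • (F (x - s) - F x) := by
    conv_lhs => rw [e2]
    rw [← integral_sub i1 i2]
    simp only [smul_sub]
  rw [e1, e3]
  refine le_trans ?_ hk2.le
  rw [← integral_const_mul]
  have hc' : Continuous fun s : Fin n → ℝ =>
      I⁻¹ * (landau a s ^ k * (ε / 2 + C * ‖s‖)) :=
    continuous_const.mul (((continuous_landau a).pow k).mul (by fun_prop))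
  refine norm_integral_le_of_norm_le ?_ ?_
  · exact (hc'.continuousOn.integrableOn_compact hD_compact)
  · filter_upwards [ae_restrict_mem hD_compact.measurableSet] with s hs
    have h0 : 0 ≤ I⁻¹ * landau a s ^ k :=
      mul_nonneg (inv_nonneg.2 hInn) (pow_nonneg (landau_nonneg ha.le haρ hs) _)
    rw [norm_smul, Real.norm_of_nonneg h0, ← mul_assoc]
    exact mul_le_mul_of_nonneg_left (hmod x s) h0

/-- Evaluation of a polynomial with continuous coefficients. -/
noncomputable def evalCoeff (t x : Fin n → ℝ) (Q : MvPolynomial (Fin n) C(Fin n → ℝ, ℝ)) : ℝ :=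
  MvPolynomial.eval₂ ((Pi.evalRingHom (fun _ : Fin n → ℝ => ℝ) t).comp ContinuousMap.coeFnRingHom)
    x Q

/-- Integration in `t` acts on the coefficients, so integrating a polynomial in `x` leaves a
polynomial in `x`. -/
lemma exists_integral_eq_eval {f : (Fin n → ℝ) → ℝ} (hf : Continuous f)
    (hfc : HasCompactSupport f) (Q : MvPolynomial (Fin n) C(Fin n → ℝ, ℝ)) :
    ∃ q : MvPolynomial (Fin n) ℝ, ∀ x, ∫ t, f t * evalCoeff t x Q = MvPolynomial.eval x q := by
  refine ⟨∑ d ∈ Q.support, MvPolynomial.monomial d (∫ t, f t * Q.coeff d t), fun x => ?_⟩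
  have h1 : ∀ t, f t * evalCoeff t x Q =
      ∑ d ∈ Q.support, (f t * Q.coeff d t) * ∏ i, x i ^ d i := by
    intro t
    rw [evalCoeff, MvPolynomial.eval₂_eq', Finset.mul_sum]
    refine Finset.sum_congr rfl fun d _ => ?_
    simp [mul_assoc]
  simp only [h1, map_sum, MvPolynomial.eval_monomial]
  rw [integral_finsetSum]
  · refine Finset.sum_congr rfl fun d _ => ?_
    rw [integral_mul_const]
    simp [Finsupp.prod_fintype]
  · intro d _
    refine Integrable.mul_const ?_ _
    exact (hf.mul (Q.coeff d).continuous).integrable_of_hasCompactSupport hfc.mul_right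

lemma exists_evalCoeff_landau (a b : ℝ) (k : ℕ) :
    ∃ Q : MvPolynomial (Fin n) C(Fin n → ℝ, ℝ), ∀ t x,
      evalCoeff t x Q = b * landau a (x - t) ^ k := by
  refine ⟨.C (.const _ b) * (1 - .C (.const _ a) *
    ∑ i, (.X i - .C ⟨fun t => t i, continuous_apply i⟩) ^ 2) ^ k, fun t x => ?_⟩
  simp [evalCoeff, landau, MvPolynomial.eval₂_sub, MvPolynomial.eval₂_sum]

/-- Polynomials are dense among the compactly supported `C¹` functions, in the `C¹` topology on
compact sets. -/
theorem exists_mvPolynomial_close {f : (Fin n → ℝ) → ℝ} (hf : ContDiff ℝ 1 f)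
    (hfc : HasCompactSupport f) {K : Set (Fin n → ℝ)} (hK : IsCompact K) {ε : ℝ} (hε : 0 < ε) :
    ∃ q : MvPolynomial (Fin n) ℝ, ∀ x ∈ K, |f x - MvPolynomial.eval x q| ≤ ε ∧
      ‖fderiv ℝ f x - fderiv ℝ (fun y => MvPolynomial.eval y q) x‖ ≤ ε := by
  obtain ⟨ρ, hρ, hρK⟩ : ∃ ρ > 0, ∀ x ∈ K, ∀ t ∈ tsupport f, ‖x - t‖ ≤ ρ := by
    obtain ⟨r₁, h₁⟩ := hK.isBounded.exists_norm_le
    obtain ⟨r₂, h₂⟩ := hfc.isCompact.isBounded.exists_norm_le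
    refine ⟨max (r₁ + r₂) 1, by positivity, fun x hx t ht => ?_⟩
    exact (norm_sub_le _ _).trans ((add_le_add (h₁ x hx) (h₂ t ht)).trans (le_max_left _ _))
  -- The summand 1 keeps `a` positive when `n = 0`.
  set a : ℝ := (n * ρ ^ 2 + 1)⁻¹ with ha_def
  have ha : 0 < a := by positivity
  have haρ : a * (n * ρ ^ 2) ≤ 1 := by
    rw [ha_def, inv_mul_le_iff₀ (by positivity)]; linarith
  have hf' : Continuous (fderiv ℝ f) := hf.continuous_fderiv one_ne_zero
  have c1 := landau_convolution_close ha hρ haρ hf.continuous hfc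
    (fun x hx t ht => hρK x hx t (subset_tsupport _ ht)) hε
  have c2 := landau_convolution_close ha hρ haρ hf' (hfc.fderiv ℝ)
    (fun x hx t ht => hρK x hx t (tsupport_fderiv_subset ℝ (subset_tsupport _ ht))) hε
  obtain ⟨k, hk1, hk2⟩ := (c1.and c2).exists
  obtain ⟨Q, hQ⟩ := exists_evalCoeff_landau (n := n) a (landauMass n a ρ k)⁻¹ k
  obtain ⟨q, hq⟩ := exists_integral_eq_eval hf.continuous hfc Q
  simp only [hQ] at hq
  set P : (Fin n → ℝ) → ℝ := fun s => (landauMass n a ρ k)⁻¹ * landau a s ^ k with hP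
  have hPc : Continuous P := continuous_const.mul ((continuous_landau a).pow k)
  have hconv : (fun y => MvPolynomial.eval y q) =
      MeasureTheory.convolution f P (ContinuousLinearMap.mul ℝ ℝ) volume := by
    funext y
    rw [← hq]
    rfl
  refine ⟨q, fun x hx => ⟨?_, ?_⟩⟩
  · have := hk1 x hx
    rw [← hq, abs_sub_comm, ← Real.norm_eq_abs]
    simpa only [smul_eq_mul, mul_comm (f _)] using this
  -- The derivative is put on `f`, so the derivative of the polynomial is the Landau convolution of
  -- `fderiv ℝ f`.
  · have hd := (hfc.hasFDerivAt_convolution_left (ContinuousLinearMap.mul ℝ ℝ) (μ := volume) hf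
      (hPc.locallyIntegrable) x).fderiv
    have e : MeasureTheory.convolution (fderiv ℝ f) P
        ((ContinuousLinearMap.mul ℝ ℝ).precompL (Fin n → ℝ)) volume x =
        ∫ t, ((landauMass n a ρ k)⁻¹ * landau a (x - t) ^ k) • fderiv ℝ f t := by
      refine integral_congr_ae (.of_forall fun t => ?_)
      ext v
      simp [ContinuousLinearMap.precompL_apply, hP, mul_comm]
    rw [hconv, hd, norm_sub_rev, e]
    exact hk2 x hx

end Weierstrass

/-! ### Approximation of continuously differentiable functions by GELU networks -/

section UniversalApproximation

open Filter Topology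

/-- The even part of the activation behaves like `2 φ t²` near `0`, where `2 φ = gelu''(0)`; hence
`c = 1 / (2 φ h²)`, with `h` so small that `h * x` stays in the region of validity. The derivative
is estimated first. Since both functions vanish at `0`, the mean value inequality on `[-R, R]` gives
the values, which is why the tolerance also includes `ε / R`. -/
lemma exists_gelu_close_sq {R ε : ℝ} (hR : 0 < R) (hε : 0 < ε) :
    ∃ c h : ℝ, ∀ x, |x| ≤ R → |c * (gelu (h * x) + gelu (-(h * x))) - x ^ 2| ≤ ε ∧
      |c * (h * (geluDeriv (h * x) - geluDeriv (-(h * x)))) - 2 * x| ≤ ε := by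
  have hφ := stdPDF_zero_pos
  set φ := stdPDF 0
  set ε₁ := min ε (ε / R) with hε₁
  have hε₁0 : 0 < ε₁ := by positivity
  have hD : HasDerivAt (fun t => geluDeriv t - geluDeriv (-t)) (4 * φ) 0 := by
    have h1 := hasDerivAt_geluDeriv_zero
    have h2 : HasDerivAt (fun t => geluDeriv (-t)) (2 * φ * (-1)) 0 :=
      HasDerivAt.comp (h₂ := geluDeriv) (0 : ℝ) (by rw [neg_zero]; exact h1) (hasDerivAt_neg 0)
    have h3 := h1.sub h2
    rw [show 2 * stdPDF 0 - 2 * φ * (-1) = 4 * φ by ring] at h3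
    exact h3
  have hlo := (hasDerivAt_iff_isLittleO.1 hD).def (c := 2 * φ * ε₁ / R) (by positivity)
  simp only [neg_zero, sub_self, sub_zero, smul_eq_mul, Real.norm_eq_abs] at hlo
  obtain ⟨δ, hδ, hδD⟩ := Metric.eventually_nhds_iff.1 hlo
  set h := δ / (2 * R) with hh
  have hh0 : 0 < h := by positivity
  set c := 1 / (2 * φ * h ^ 2) with hc
  have hderiv : ∀ x, |x| ≤ R →
      |c * (h * (geluDeriv (h * x) - geluDeriv (-(h * x)))) - 2 * x| ≤ ε₁ := by
    intro x hx
    have h1 : |h * x| < δ := by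
      rw [abs_mul, abs_of_pos hh0]
      calc h * |x| ≤ h * R := by gcongr
        _ = δ / 2 := by rw [hh]; field_simp
        _ < δ := by linarith
    have h2 := hδD (y := h * x) (by simpa [Real.dist_eq] using h1)
    have h3 : c * (h * (geluDeriv (h * x) - geluDeriv (-(h * x)))) - 2 * x =
        (2 * φ * h)⁻¹ * (geluDeriv (h * x) - geluDeriv (-(h * x)) - h * x * (4 * φ)) := by
      rw [hc]; field_simp; ring
    rw [h3, abs_mul, abs_of_pos (by positivity : 0 < (2 * φ * h)⁻¹)]
    calc (2 * φ * h)⁻¹ * |geluDeriv (h * x) - geluDeriv (-(h * x)) - h * x * (4 * φ)|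
        ≤ (2 * φ * h)⁻¹ * (2 * φ * ε₁ / R * |h * x|) := by gcongr
      _ = ε₁ * (|x| / R) := by rw [abs_mul, abs_of_pos hh0]; field_simp
      _ ≤ ε₁ * 1 := by gcongr; exact (div_le_one hR).2 hx
      _ = ε₁ := mul_one _
  refine ⟨c, h, fun x hx => ⟨?_, (hderiv x hx).trans (min_le_left _ _)⟩⟩
  have hder : ∀ y, HasDerivAt (fun x => c * (gelu (h * x) + gelu (-(h * x))) - x ^ 2)
      (c * (h * (geluDeriv (h * y) - geluDeriv (-(h * y)))) - 2 * y) y := by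
    intro y
    have a1 : HasDerivAt (fun x => h * x) h y := by simpa using (hasDerivAt_id y).const_mul h
    have a2 := (hasDerivAt_gelu (h * y)).comp y a1
    have a3 := (hasDerivAt_gelu (-(h * y))).comp y a1.neg
    have a4 := ((a2.add a3).const_mul c).sub (hasDerivAt_pow 2 y)
    have e : c * (geluDeriv (h * y) * h + geluDeriv (-(h * y)) * -h) - (2 : ℕ) * y ^ (2 - 1) =
      c * (h * (geluDeriv (h * y) - geluDeriv (-(h * y)))) - 2 * y := by
        push_cast; ring
    rw [e] at a4
    exact a4
  have hmv := (convex_closedBall (0 : ℝ) R).norm_image_sub_le_of_norm_hasDerivWithin_le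
    (fun y _ => (hder y).hasDerivWithinAt)
    (fun y hy => hderiv y (by simpa using hy)) (x := 0) (y := x) (by simpa using hR.le)
    (by simpa using hx)
  have h0 : gelu 0 = 0 := by simp [gelu_eq]
  simp only [mul_zero, neg_zero, h0, add_zero, Real.norm_eq_abs, sub_zero,
    ne_eq, OfNat.ofNat_ne_zero, not_false_eq_true, zero_pow] at hmv
  calc _ ≤ ε₁ * |x| := hmv
    _ ≤ (ε / R) * R := by gcongr; exact min_le_right _ _
    _ = ε := by field_simp

variable {ι : Type} [Fintype ι]

/-- Functions that GELU networks approximate in the `C¹` topology on compact sets. -/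
def IsNetLimit (f : (ι → ℝ) → ℝ) : Prop :=
  ContDiff ℝ 1 f ∧ ∀ K : Set (ι → ℝ), IsCompact K → ∀ ε > 0, ∃ g, IsScalarNet g ∧
    ∀ x ∈ K, |f x - g x| ≤ ε ∧ ‖fderiv ℝ f x - fderiv ℝ g x‖ ≤ ε

lemma IsScalarNet.isNetLimit {f : (ι → ℝ) → ℝ} (hf : IsScalarNet f) : IsNetLimit f :=
  ⟨hf.contDiff, fun _ _ ε hε => ⟨f, hf, fun x _ => by simp [hε.le]⟩⟩

namespace IsNetLimit

variable {f g : (ι → ℝ) → ℝ}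

lemma linear_comb (hf : IsNetLimit f) (hg : IsNetLimit g) (a b : ℝ) :
    IsNetLimit fun x => a * f x + b * g x := by
  refine ⟨(contDiff_const.mul hf.1).add (contDiff_const.mul hg.1), fun K hK ε hε => ?_⟩
  set η := ε / (|a| + |b| + 1) with hη
  have hη0 : 0 < η := by positivity
  obtain ⟨f', hf', hff'⟩ := hf.2 K hK η hη0
  obtain ⟨g', hg', hgg'⟩ := hg.2 K hK η hη0
  have hsum : |a| * η + |b| * η ≤ ε := by
    have : (|a| + |b| + 1) * η = ε := by rw [hη]; field_simp
    nlinarith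
  refine ⟨_, hf'.linear_comb hg' a b, fun x hx => ⟨?_, ?_⟩⟩
  · have e : a * f x + b * g x - (a * f' x + b * g' x) =
        a * (f x - f' x) + b * (g x - g' x) := by ring
    rw [e]
    refine (abs_add_le _ _).trans (le_trans ?_ hsum)
    rw [abs_mul, abs_mul]
    gcongr
    · exact (hff' x hx).1
    · exact (hgg' x hx).1
  · have d : ∀ {f g : (ι → ℝ) → ℝ}, ContDiff ℝ 1 f → ContDiff ℝ 1 g →
        fderiv ℝ (fun x => a * f x + b * g x) x = a • fderiv ℝ f x + b • fderiv ℝ g x := by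
      intro f g hf hg
      exact (((hf.differentiable one_ne_zero x).hasFDerivAt.const_mul a).add
        ((hg.differentiable one_ne_zero x).hasFDerivAt.const_mul b)).fderiv
    rw [d hf.1 hg.1, d hf'.contDiff hg'.contDiff]
    have e : a • fderiv ℝ f x + b • fderiv ℝ g x - (a • fderiv ℝ f' x + b • fderiv ℝ g' x) =
        a • (fderiv ℝ f x - fderiv ℝ f' x) + b • (fderiv ℝ g x - fderiv ℝ g' x) := by module
    rw [e]
    refine (norm_add_le _ _).trans (le_trans ?_ hsum)
    rw [norm_smul, norm_smul, Real.norm_eq_abs, Real.norm_eq_abs]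
    gcongr
    · exact (hff' x hx).2
    · exact (hgg' x hx).2

lemma sq (hf : IsNetLimit f) : IsNetLimit fun x => f x ^ 2 := by
  refine ⟨hf.1.pow 2, fun K hK ε hε => ?_⟩
  obtain ⟨A, hA⟩ := hK.exists_bound_of_continuousOn hf.1.continuous.continuousOn
  obtain ⟨A', hA'⟩ := hK.exists_bound_of_continuousOn
    (hf.1.continuous_fderiv one_ne_zero).continuousOn
  set R := max (max A A') 0 + 1 with hR
  have hR1 : 1 ≤ R := by simp [hR]
  have hRA : ∀ x ∈ K, |f x| ≤ R - 1 := fun x hx =>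
    (hA x hx).trans (by simp [hR])
  have hRA' : ∀ x ∈ K, ‖fderiv ℝ f x‖ ≤ R - 1 := fun x hx =>
    (hA' x hx).trans (by simp [hR])
  -- In the derivative estimate, replacing `f` by `g` costs `4 * R * η ≤ ε / 2`, and replacing the
  -- square by the network costs another `ε / 2`. The bound `η ≤ 1` keeps `g` and its derivative
  -- below `R`.
  set η := min 1 (ε / (8 * R)) with hη
  have hη0 : 0 < η := by positivity
  have hη1 : η ≤ 1 := min_le_left _ _
  have hηε : R * η ≤ ε / 8 := by
    calc R * η ≤ R * (ε / (8 * R)) := by gcongr; exact min_le_right _ _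
      _ = ε / 8 := by field_simp
  obtain ⟨g, hg, hfg⟩ := hf.2 K hK η hη0
  obtain ⟨c, h, hch⟩ := exists_gelu_close_sq (R := R) (ε := ε / (2 * R)) (by linarith)
    (by positivity)
  have hεR : ε / (2 * R) ≤ ε / 2 := by
    apply div_le_div_of_nonneg_left hε.le (by norm_num) (by linarith)
  have hN : IsScalarNet fun x => c * (gelu (h * g x) + gelu (-(h * g x))) := by
    refine (((hg.const_mul h).gelu_comp).add ?_).const_mul c
    have := (hg.const_mul (-h)).gelu_comp
    simpa only [neg_mul] using this
  refine ⟨_, hN, fun x hx => ?_⟩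
  obtain ⟨hv, hd⟩ := hfg x hx
  have hgR : |g x| ≤ R := by
    have := abs_sub_abs_le_abs_sub (g x) (f x)
    rw [abs_sub_comm] at this
    linarith [hRA x hx]
  have hdR : ‖fderiv ℝ g x‖ ≤ R := by
    have := norm_sub_norm_le (fderiv ℝ g x) (fderiv ℝ f x)
    rw [norm_sub_rev] at this
    linarith [hRA' x hx]
  obtain ⟨h1, h2⟩ := hch (g x) hgR
  constructor
  · have e1 : |f x ^ 2 - g x ^ 2| ≤ 2 * R * η := by
      have : f x ^ 2 - g x ^ 2 = (f x + g x) * (f x - g x) := by ring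
      rw [this, abs_mul]
      have := abs_add_le (f x) (g x)
      gcongr
      linarith [hRA x hx]
    have e2 := abs_sub_le (f x ^ 2) (g x ^ 2) (c * (gelu (h * g x) + gelu (-(h * g x))))
    rw [abs_sub_comm (g x ^ 2)] at e2
    linarith
  · have df : HasFDerivAt (fun x => f x ^ 2) ((2 * f x) • fderiv ℝ f x) x := by
      have := (hf.1.differentiable one_ne_zero x).hasFDerivAt.pow 2
      rwa [show (2 • f x ^ (2 - 1)) = 2 * f x by simp] at this
    have dg := (hg.contDiff.differentiable one_ne_zero x).hasFDerivAt
    have dN : HasFDerivAt (fun x => c * (gelu (h * g x) + gelu (-(h * g x))))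
        ((c * (h * (geluDeriv (h * g x) - geluDeriv (-(h * g x))))) • fderiv ℝ g x) x := by
      have a1 := dg.const_mul h
      have a2 := (hasDerivAt_gelu (h * g x)).comp_hasFDerivAt x a1
      have a3 := (hasDerivAt_gelu (-(h * g x))).comp_hasFDerivAt x a1.neg
      refine ((a2.add a3).const_mul c).congr_fderiv ?_
      ext v
      simp
      ring
    rw [df.fderiv, dN.fderiv]
    set s := c * (h * (geluDeriv (h * g x) - geluDeriv (-(h * g x))))
    have e : (2 * f x) • fderiv ℝ f x - s • fderiv ℝ g x =
        (2 * f x) • (fderiv ℝ f x - fderiv ℝ g x) + (2 * (f x - g x)) • fderiv ℝ g x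
          - (s - 2 * g x) • fderiv ℝ g x := by module
    rw [e]
    refine (norm_sub_le _ _).trans ((add_le_add (norm_add_le _ _) le_rfl).trans ?_)
    rw [norm_smul, norm_smul, norm_smul, Real.norm_eq_abs, Real.norm_eq_abs, Real.norm_eq_abs,
      abs_mul, abs_mul, abs_two]
    have b1 : 2 * |f x| * ‖fderiv ℝ f x - fderiv ℝ g x‖ ≤ 2 * R * η := by
      gcongr
      linarith [hRA x hx]
    have b2 : 2 * |f x - g x| * ‖fderiv ℝ g x‖ ≤ 2 * η * R := by gcongr
    have b3 : |s - 2 * g x| * ‖fderiv ℝ g x‖ ≤ ε / (2 * R) * R := by gcongr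
    have b4 : ε / (2 * R) * R = ε / 2 := by field_simp
    linarith

/-- Polarization: `4 f g = (f + g)² - (f - g)²`. -/
lemma mul (hf : IsNetLimit f) (hg : IsNetLimit g) : IsNetLimit fun x => f x * g x := by
  have := ((hf.linear_comb hg 1 1).sq).linear_comb ((hf.linear_comb hg 1 (-1)).sq) (1 / 4) (-1 / 4)
  convert this using 2 with x
  ring

lemma add (hf : IsNetLimit f) (hg : IsNetLimit g) : IsNetLimit fun x => f x + g x := by
  simpa using hf.linear_comb hg 1 1

end IsNetLimit

lemma isNetLimit_eval (q : MvPolynomial ι ℝ) : IsNetLimit fun x => MvPolynomial.eval x q := by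
  induction q using MvPolynomial.induction_on with
  | C a => simpa using (IsScalarNet.const a).isNetLimit
  | add p q hp hq => simpa using hp.add hq
  | mul_X p i hp => simpa using hp.mul (IsScalarNet.coord i).isNetLimit

/-- **Universal approximation**: GELU networks approximate a function that is `C¹` on an open set,
together with its derivative, uniformly on compact subsets. -/
theorem exists_isScalarNet_close {n : ℕ} {f : (Fin n → ℝ) → ℝ} {O K : Set (Fin n → ℝ)}
    (hO : IsOpen O) (hf : ContDiffOn ℝ 1 f O) (hK : IsCompact K) (hKO : K ⊆ O) {ε : ℝ}
    (hε : 0 < ε) :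
    ∃ g, IsScalarNet g ∧ ∀ x ∈ K, |f x - g x| ≤ ε ∧ ‖fderiv ℝ f x - fderiv ℝ g x‖ ≤ ε := by
  obtain ⟨L, hL, hKL, hLO⟩ := exists_compact_between hK hO hKO
  -- The cutoff equals 1 near `K`, not merely on it, so `χ f` and `f` also share their derivatives
  -- on `K`; it vanishes off `L`, so nothing is asked of `f` outside `O`.
  obtain ⟨χ, hχ1, hχ0, -⟩ := exists_contMDiffMap_one_nhds_of_subset_interior
    (n := 1) (modelWithCornersSelf ℝ (Fin n → ℝ)) hK.isClosed hKL
  have hχ : ContDiff ℝ 1 χ := χ.contMDiff.contDiff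
  have hF : ContDiff ℝ 1 fun x => χ x * f x := by
    refine contDiff_of_contDiffOn_union_of_isOpen (s := O) (t := Lᶜ) (hχ.contDiffOn.mul hf) ?_ ?_
      hO hL.isClosed.isOpen_compl
    · refine (contDiffOn_const (c := (0 : ℝ))).congr fun x hx => ?_
      rw [hχ0 x hx, zero_mul]
    · rw [Set.eq_univ_iff_forall]
      intro x
      by_cases hx : x ∈ L
      · exact .inl (hLO hx)
      · exact .inr hx
  have hFc : HasCompactSupport fun x => χ x * f x :=
    HasCompactSupport.intro hL fun x hx => by rw [hχ0 x hx, zero_mul]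
  obtain ⟨q, hq⟩ := exists_mvPolynomial_close hF hFc hK (half_pos hε)
  obtain ⟨g, hg, hqg⟩ := (isNetLimit_eval q).2 K hK (ε / 2) (half_pos hε)
  refine ⟨g, hg, fun x hx => ?_⟩
  have hnear : (fun x => χ x * f x) =ᶠ[𝓝 x] f := by
    filter_upwards [(eventually_nhdsSet_iff_forall.1 hχ1) x hx] with y hy
    rw [hy, one_mul]
  have h1 := hq x hx
  have h2 := hqg x hx
  rw [hnear.fderiv_eq, hnear.eq_of_nhds] at h1
  exact ⟨(abs_sub_le _ _ _).trans (by linarith [h1.1, h2.1]),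
    (norm_sub_le_norm_sub_add_norm_sub _ _ _).trans (by linarith [h1.2, h2.2])⟩

end UniversalApproximation

/-! ### Reduced bases -/

section ReducedBasis

open Filter Topology

variable {X : Type*} [NormedAddCommGroup X] [InnerProductSpace ℝ X] {N : ℕ∞}

lemma basisIndex_injective {r : ℕ} (hr : (r : ℕ∞) ≤ N) :
    Function.Injective (basisIndex hr) := by
  intro i j h
  exact Fin.ext (congrArg (fun k : BasisIndex N => (k : ℕ)) h)

/-- The largest rank that is at most `r` and does not exceed the dimension `N`. -/
noncomputable def cappedRank (N : ℕ∞) (r : ℕ) : ℕ := (min (r : ℕ∞) N).toNat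

lemma coe_cappedRank (N : ℕ∞) (r : ℕ) : (cappedRank N r : ℕ∞) = min (r : ℕ∞) N :=
  ENat.natCast_toNat (ne_top_of_le_ne_top (ENat.natCast_ne_top r) (min_le_left _ _))

lemma cappedRank_le (N : ℕ∞) (r : ℕ) : (cappedRank N r : ℕ∞) ≤ N := by
  rw [coe_cappedRank]; exact min_le_right _ _

/-- The first basis indices. -/
noncomputable def firstIndices (N : ℕ∞) (r : ℕ) : Finset (BasisIndex N) :=
  Finset.univ.map ⟨basisIndex (cappedRank_le N r), basisIndex_injective _⟩

lemma mem_firstIndices {r : ℕ} {i : BasisIndex N} : i ∈ firstIndices N r ↔ (i : ℕ) < r := by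
  simp only [firstIndices, Finset.mem_map, Finset.mem_univ, true_and, Function.Embedding.coeFn_mk]
  constructor
  · rintro ⟨j, rfl⟩
    have h : ((j : ℕ) : ℕ∞) < cappedRank N r := Nat.cast_lt.2 j.isLt
    rw [coe_cappedRank] at h
    exact Nat.cast_lt.1 (h.trans_le (min_le_left _ _))
  · intro h
    have h2 : ((i : ℕ) : ℕ∞) < cappedRank N r := by
      rw [coe_cappedRank]; exact lt_min (Nat.cast_lt.2 h) i.2
    exact ⟨⟨i, Nat.cast_lt.1 h2⟩, rfl⟩

lemma monotone_firstIndices : Monotone (firstIndices N) := fun _ _ h _ hi =>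
  mem_firstIndices.2 ((mem_firstIndices.1 hi).trans_le h)

lemma tendsto_firstIndices : Tendsto (firstIndices N) atTop atTop :=
  tendsto_atTop_finset_of_monotone monotone_firstIndices fun i =>
    ⟨i + 1, mem_firstIndices.2 (Nat.lt_succ_self _)⟩

lemma decode_encode_cappedRank (e : HilbertBasis (BasisIndex N) ℝ X) (r : ℕ) (x : X) :
    decode e (cappedRank_le N r) (encode e (cappedRank_le N r) x) =
      ∑ i ∈ firstIndices N r, inner ℝ (e i) x • e i := by
  simp [decode, encode, firstIndices]

lemma norm_sub_sum_sq {ι : Type*} {v : ι → X} (hv : Orthonormal ℝ v) (s : Finset ι) (x : X) :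
    ‖x - ∑ i ∈ s, inner ℝ (v i) x • v i‖ ^ 2 = ‖x‖ ^ 2 - ∑ i ∈ s, (inner ℝ (v i) x) ^ 2 := by
  have h1 : inner ℝ x (∑ i ∈ s, inner ℝ (v i) x • v i) = ∑ i ∈ s, (inner ℝ (v i) x) ^ 2 := by
    rw [inner_sum]
    refine Finset.sum_congr rfl fun i _ => ?_
    rw [inner_smul_right, real_inner_comm, sq]
  have h2 : ‖∑ i ∈ s, inner ℝ (v i) x • v i‖ ^ 2 = ∑ i ∈ s, (inner ℝ (v i) x) ^ 2 := by
    rw [← real_inner_self_eq_norm_sq, hv.inner_sum]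
    simp [sq]
  rw [norm_sub_sq_real, h1, h2]
  ring

lemma norm_decode_sq (e : HilbertBasis (BasisIndex N) ℝ X) {r : ℕ} (hr : (r : ℕ∞) ≤ N)
    (c : Fin r → ℝ) : ‖decode e hr c‖ ^ 2 = ∑ i, c i ^ 2 := by
  have h := (e.orthonormal.comp _ (basisIndex_injective hr)).inner_sum c c Finset.univ
  simp only [Function.comp_apply] at h
  rw [← real_inner_self_eq_norm_sq, decode, h]
  simp [sq]

lemma norm_decode_le (e : HilbertBasis (BasisIndex N) ℝ X) {r : ℕ} (hr : (r : ℕ∞) ≤ N)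
    {c x : Fin r → ℝ} {C : ℝ} (hC : 0 ≤ C) (h : ∀ i, |c i| ≤ C * |x i|) :
    ‖decode e hr c‖ ≤ C * ‖decode e hr x‖ := by
  refine (sq_le_sq₀ (norm_nonneg _) (by positivity)).1 ?_
  rw [mul_pow, norm_decode_sq, norm_decode_sq, Finset.mul_sum]
  refine Finset.sum_le_sum fun i _ => ?_
  have := pow_le_pow_left₀ (abs_nonneg _) (h i) 2
  rwa [mul_pow, sq_abs, sq_abs] at this

lemma decode_sub (e : HilbertBasis (BasisIndex N) ℝ X) {r : ℕ} (hr : (r : ℕ∞) ≤ N)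
    (c c' : Fin r → ℝ) : decode e hr (fun i => c i - c' i) = decode e hr c - decode e hr c' := by
  simp [decode, sub_smul]

lemma norm_decode_le_sum (e : HilbertBasis (BasisIndex N) ℝ X) {r : ℕ} (hr : (r : ℕ∞) ≤ N)
    (c : Fin r → ℝ) : ‖decode e hr c‖ ≤ ∑ i, |c i| := by
  refine (norm_sum_le _ _).trans (Finset.sum_le_sum fun i _ => ?_)
  rw [norm_smul, e.orthonormal.1, mul_one, Real.norm_eq_abs]

/-- The distance to the span of the first basis vectors. -/
noncomputable def residual (e : HilbertBasis (BasisIndex N) ℝ X) (r : ℕ) (x : X) : ℝ :=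
  ‖x - decode e (cappedRank_le N r) (encode e (cappedRank_le N r) x)‖

lemma residual_sq (e : HilbertBasis (BasisIndex N) ℝ X) (r : ℕ) (x : X) :
    residual e r x ^ 2 = ‖x‖ ^ 2 - ∑ i ∈ firstIndices N r, (inner ℝ (e i) x) ^ 2 := by
  rw [residual, decode_encode_cappedRank, norm_sub_sum_sq e.orthonormal]

lemma residual_le (e : HilbertBasis (BasisIndex N) ℝ X) (r : ℕ) (x : X) :
    residual e r x ≤ ‖x‖ := by
  refine (sq_le_sq₀ (norm_nonneg _) (norm_nonneg _)).1 ?_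
  change residual e r x ^ 2 ≤ _
  rw [residual_sq]
  have : 0 ≤ ∑ i ∈ firstIndices N r, (inner ℝ (e i) x) ^ 2 :=
    Finset.sum_nonneg fun _ _ => sq_nonneg _
  linarith

lemma norm_decode_encode_le (e : HilbertBasis (BasisIndex N) ℝ X) (r : ℕ) (x : X) :
    ‖decode e (cappedRank_le N r) (encode e (cappedRank_le N r) x)‖ ≤ 2 * ‖x‖ := by
  have h1 := residual_le e r x
  have h2 := norm_sub_norm_le (decode e (cappedRank_le N r) (encode e (cappedRank_le N r) x)) x
  rw [norm_sub_rev] at h2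
  rw [residual] at h1
  linarith

/-- A larger rank removes more squared coefficients. This monotonicity is the hypothesis of Dini's
theorem below. -/
lemma antitone_residual (e : HilbertBasis (BasisIndex N) ℝ X) (x : X) :
    Antitone fun r => residual e r x := by
  intro r s h
  refine (sq_le_sq₀ (norm_nonneg _) (norm_nonneg _)).1 ?_
  change residual e s x ^ 2 ≤ residual e r x ^ 2
  rw [residual_sq, residual_sq]
  have := Finset.sum_le_sum_of_subset_of_nonneg (f := fun i => (inner ℝ (e i) x) ^ 2)
    (monotone_firstIndices (N := N) h) fun _ _ _ => sq_nonneg _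
  linarith

lemma continuous_encode (e : HilbertBasis (BasisIndex N) ℝ X) {r : ℕ} (hr : (r : ℕ∞) ≤ N) :
    Continuous (encode e hr) := by
  unfold encode; fun_prop

lemma contDiff_encode (e : HilbertBasis (BasisIndex N) ℝ X) {r : ℕ} (hr : (r : ℕ∞) ≤ N) :
    ContDiff ℝ 1 (encode e hr) := by
  unfold encode
  exact contDiff_pi.2 fun i => contDiff_const.inner ℝ contDiff_id

lemma contDiff_decode (e : HilbertBasis (BasisIndex N) ℝ X) {r : ℕ} (hr : (r : ℕ∞) ≤ N) :
    ContDiff ℝ 1 (decode e hr) := by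
  unfold decode; fun_prop

lemma continuous_residual (e : HilbertBasis (BasisIndex N) ℝ X) (r : ℕ) :
    Continuous (residual e r) := by
  unfold residual
  exact (continuous_id.sub ((contDiff_decode e _).continuous.comp (continuous_encode e _))).norm

lemma tendsto_residual (e : HilbertBasis (BasisIndex N) ℝ X) (x : X) :
    Tendsto (fun r => residual e r x) atTop (𝓝 0) := by
  have h := (e.hasSum_repr x).comp tendsto_firstIndices
  have h2 := (tendsto_const_nhds (x := x)).sub h |>.norm
  rw [sub_self, norm_zero] at h2
  refine h2.congr fun r => ?_
  simp only [residual, decode_encode_cappedRank, Function.comp_apply, e.repr_apply_apply]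

/-- Orthogonal projections onto the first basis vectors converge uniformly on compact sets. -/
lemma exists_residual_le (e : HilbertBasis (BasisIndex N) ℝ X) {C : Set X} (hC : IsCompact C)
    {ε : ℝ} (hε : 0 < ε) : ∃ r, ∀ x ∈ C, residual e r x ≤ ε := by
  have h := Antitone.tendstoUniformlyOn_of_forall_tendsto (F := residual e) (f := fun _ => (0 : ℝ))
    hC (fun r => (continuous_residual e r).continuousOn) (fun x _ => antitone_residual e x)
    continuousOn_const (fun x _ => tendsto_residual e x)
  obtain ⟨r, hr⟩ := (Metric.tendstoUniformlyOn_iff.1 h ε hε).exists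
  refine ⟨r, fun x hx => ?_⟩
  have := hr x hx
  rw [Real.dist_eq, zero_sub, abs_neg] at this
  exact (le_abs_self _).trans this.le

/-- Closeness of derivatives in operator norm is thereby reduced to finitely many vectors of the
Hilbert space, to which compactness applies. -/
lemma opNorm_le_sum {n : ℕ} {Y : Type*} [NormedAddCommGroup Y] [NormedSpace ℝ Y]
    (T : (Fin n → ℝ) →L[ℝ] Y) : ‖T‖ ≤ ∑ j, ‖T (Pi.single j 1)‖ := by
  refine T.opNorm_le_bound (Finset.sum_nonneg fun _ _ => norm_nonneg _) fun v => ?_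
  have h : T v = ∑ j, v j • T (Pi.single j 1) := by
    conv_lhs => rw [pi_eq_sum_univ' v]
    simp [map_sum]
  rw [h, Finset.sum_mul]
  refine (norm_sum_le _ _).trans (Finset.sum_le_sum fun j _ => ?_)
  rw [norm_smul, mul_comm]
  exact mul_le_mul_of_nonneg_left (norm_le_pi_norm v j) (norm_nonneg _)

/-- **Universal approximation with values in a Hilbert space**: decoded GELU networks approximate
a `C¹` map together with its derivative, uniformly on compact sets. -/
theorem exists_isGeluNet_decode_close (e : HilbertBasis (BasisIndex N) ℝ X) {n : ℕ}
    {F : (Fin n → ℝ) → X} {O K : Set (Fin n → ℝ)} (hO : IsOpen O) (hF : ContDiffOn ℝ 1 F O)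
    (hK : IsCompact K) (hKO : K ⊆ O) {ε : ℝ} (hε : 0 < ε) :
    ∃ (r : ℕ) (hr : (r : ℕ∞) ≤ N) (g : (Fin n → ℝ) → (Fin r → ℝ)), IsGeluNet g ∧
      ∀ y ∈ K, ‖F y - decode e hr (g y)‖ ≤ ε ∧
        ‖fderiv ℝ F y - fderiv ℝ (fun y => decode e hr (g y)) y‖ ≤ ε := by
  have hF' : ContinuousOn (fderiv ℝ F) K :=
    (hF.continuousOn_fderiv_of_isOpen hO le_rfl).mono hKO
  have hdiff : ∀ y ∈ K, DifferentiableAt ℝ F y := fun y hy =>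
    (hF.differentiableOn one_ne_zero).differentiableAt (hO.mem_nhds (hKO hy))
  -- Values and partial derivatives are put in one compact set, so that one rank serves both. The
  -- tolerance below is divided by `n + 1` because the `n` partial derivatives are summed.
  have hC : IsCompact (F '' K ∪ ⋃ j, (fun y => fderiv ℝ F y (Pi.single j 1)) '' K) := by
    refine (hK.image_of_continuousOn (hF.continuousOn.mono hKO)).union
      (isCompact_iUnion fun j => hK.image_of_continuousOn ?_)
    exact hF'.clm_apply continuousOn_const
  obtain ⟨k, hk⟩ := exists_residual_le e hC (show 0 < ε / (2 * (n + 1)) by positivity)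
  have hk0 : ε / (2 * (n + 1)) ≤ ε / 2 := by
    apply div_le_div_of_nonneg_left hε.le (by norm_num); linarith [n.cast_nonneg (α := ℝ)]
  have hkn : n * (ε / (2 * (n + 1))) ≤ ε / 2 := by
    rw [← mul_div_assoc, div_le_div_iff₀ (by positivity) (by positivity)]
    nlinarith
  set r := cappedRank N k with hr_def
  have hr : (r : ℕ∞) ≤ N := cappedRank_le N k
  have hfi : ∀ i : Fin r, ContDiffOn ℝ 1 (fun y => inner ℝ (e (basisIndex hr i)) (F y)) O :=
    fun i => contDiffOn_const.inner ℝ hF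
  set η := ε / (2 * (r + 1)) with hη
  have hη0 : 0 < η := by positivity
  have hηr : r * η ≤ ε / 2 := by
    rw [hη, ← mul_div_assoc, div_le_div_iff₀ (by positivity) (by positivity)]
    nlinarith
  choose g hg hgc using fun i => exists_isScalarNet_close hO (hfi i) hK hKO hη0
  refine ⟨r, hr, fun y i => g i y, IsGeluNet.pi hg, fun y hy => ⟨?_, ?_⟩⟩
  · have h1 : ‖F y - decode e hr (encode e hr (F y))‖ ≤ ε / 2 :=
      (hk _ (.inl ⟨y, hy, rfl⟩)).trans hk0
    have h2 : ‖decode e hr (encode e hr (F y)) - decode e hr (fun i => g i y)‖ ≤ ε / 2 := by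
      rw [← decode_sub]
      refine (norm_decode_le_sum e hr _).trans ?_
      refine (Finset.sum_le_sum (g := fun _ => η) fun i _ => (hgc i y hy).1).trans ?_
      simpa using hηr
    exact (norm_sub_le_norm_sub_add_norm_sub _ _ _).trans (by linarith)
  · have d1 : HasFDerivAt (fun y => decode e hr (fun i => g i y))
        (∑ i, (fderiv ℝ (g i) y).smulRight (e (basisIndex hr i))) y := by
      unfold decode
      exact HasFDerivAt.fun_sum fun i _ =>
        ((hg i).contDiff.differentiable one_ne_zero y).hasFDerivAt.smul_const _
    -- `T` is the derivative of `F` followed by orthogonal projection; it separates the projection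
    -- error from the network error.
    set T := ∑ i, (fderiv ℝ (fun y => inner ℝ (e (basisIndex hr i)) (F y)) y).smulRight
      (e (basisIndex hr i)) with hT
    have hTv : ∀ v, T v = decode e hr (encode e hr (fderiv ℝ F y v)) := by
      intro v
      simp only [hT, sum_apply, ContinuousLinearMap.smulRight_apply, decode,
        encode]
      refine Finset.sum_congr rfl fun i _ => ?_
      congr 1
      rw [fderiv_inner_apply ℝ (differentiableAt_const _) (hdiff y hy)]
      simp
    rw [d1.fderiv]
    have h1 : ‖fderiv ℝ F y - T‖ ≤ ε / 2 := by
      refine (opNorm_le_sum _).trans (le_trans ?_ hkn)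
      refine (Finset.sum_le_sum (g := fun _ => ε / (2 * (n + 1))) fun j _ => ?_).trans (by simp)
      rw [sub_apply, hTv]
      exact hk _ (.inr (Set.mem_iUnion.2 ⟨j, ⟨y, hy, rfl⟩⟩))
    have h2 : ‖T - ∑ i, (fderiv ℝ (g i) y).smulRight (e (basisIndex hr i))‖ ≤ ε / 2 := by
      rw [hT, ← Finset.sum_sub_distrib]
      refine (norm_sum_le _ _).trans ?_
      refine (Finset.sum_le_sum (g := fun _ => η) fun i _ => ?_).trans (by simpa using hηr)
      have : ∀ (A B : (Fin n → ℝ) →L[ℝ] ℝ) (x : X),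
          A.smulRight x - B.smulRight x = (A - B).smulRight x := by
        intro A B x; ext v; simp [sub_smul]
      rw [this, ContinuousLinearMap.norm_smulRight_apply, e.orthonormal.1, mul_one]
      exact (hgc i y hy).2
    exact (norm_sub_le_norm_sub_add_norm_sub _ _ _).trans (by linarith)

end ReducedBasis

/-! ### Growth of the quantity of interest -/

section Growth

open Filter Topology

variable {U M Z : Type*} [NormedAddCommGroup U] [InnerProductSpace ℝ U]
  [NormedAddCommGroup M] [InnerProductSpace ℝ M] [NormedAddCommGroup Z] [InnerProductSpace ℝ Z]
  {B : Set Z} {Q : U → M → Z → ℝ}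

omit [InnerProductSpace ℝ U] [InnerProductSpace ℝ M] [InnerProductSpace ℝ Z] in
lemma isOpen_third (hB : IsOpen B) : IsOpen {x : U × M × Z | x.2.2 ∈ B} :=
  hB.preimage (by fun_prop)

namespace QoIAssumption

lemma hasFDerivAt (hQ : QoIAssumption B Q) (hB : IsOpen B) (v : U) (m : M) {z : Z} (hz : z ∈ B) :
    HasFDerivAt (fun x : U × M × Z => Q x.1 x.2.1 x.2.2)
      (fderiv ℝ (fun x : U × M × Z => Q x.1 x.2.1 x.2.2) (v, m, z)) (v, m, z) :=
  ((hQ.contDiff.differentiableOn two_ne_zero).differentiableAt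
    ((isOpen_third hB).mem_nhds hz)).hasFDerivAt

lemma hasFDerivAt_DuQ (hQ : QoIAssumption B Q) (hB : IsOpen B) (v : U) (m : M) {z : Z}
    (hz : z ∈ B) : HasFDerivAt (fun v' => Q v' m z) (DuQ Q v m z) v := by
  have h := (hQ.hasFDerivAt hB v m hz).comp (f := fun v' => (v', m, z)) v
    ((hasFDerivAt_id v).prodMk (hasFDerivAt_const (m, z) v))
  exact h.differentiableAt.hasFDerivAt

/-- Writing a partial derivative as a restriction of the full one yields its joint continuity in all
variables. -/
lemma DuQ_eq (hQ : QoIAssumption B Q) (hB : IsOpen B) (v : U) (m : M) {z : Z} (hz : z ∈ B) :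
    DuQ Q v m z = (fderiv ℝ (fun x : U × M × Z => Q x.1 x.2.1 x.2.2) (v, m, z)).comp
      (ContinuousLinearMap.inl ℝ U (M × Z)) := by
  have h := (hQ.hasFDerivAt hB v m hz).comp (f := fun v' => (v', m, z)) v
    ((hasFDerivAt_id v).prodMk (hasFDerivAt_const (m, z) v))
  exact h.fderiv

lemma DzQ_eq (hQ : QoIAssumption B Q) (hB : IsOpen B) (v : U) (m : M) {z : Z} (hz : z ∈ B) :
    DzQ Q v m z = (fderiv ℝ (fun x : U × M × Z => Q x.1 x.2.1 x.2.2) (v, m, z)).comp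
      ((ContinuousLinearMap.inr ℝ U (M × Z)).comp (ContinuousLinearMap.inr ℝ M Z)) := by
  have h := (hQ.hasFDerivAt hB v m hz).comp (f := fun z' => (v, m, z')) z
    ((hasFDerivAt_const v z).prodMk ((hasFDerivAt_const m z).prodMk (hasFDerivAt_id z)))
  exact h.fderiv

lemma contDiffOn_fderiv (hQ : QoIAssumption B Q) (hB : IsOpen B) :
    ContDiffOn ℝ 1 (fderiv ℝ (fun x : U × M × Z => Q x.1 x.2.1 x.2.2)) {x | x.2.2 ∈ B} :=
  hQ.contDiff.fderiv_of_isOpen (isOpen_third hB) (by norm_num)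

lemma continuousOn_DuQ (hQ : QoIAssumption B Q) (hB : IsOpen B) :
    ContinuousOn (fun x : U × M × Z => DuQ Q x.1 x.2.1 x.2.2) {x | x.2.2 ∈ B} :=
  ((hQ.contDiffOn_fderiv hB).continuousOn.clm_comp continuousOn_const).congr
    fun x hx => hQ.DuQ_eq hB x.1 x.2.1 hx

lemma contDiffOn_DzQ (hQ : QoIAssumption B Q) (hB : IsOpen B) :
    ContDiffOn ℝ 1 (fun x : U × M × Z => DzQ Q x.1 x.2.1 x.2.2) {x | x.2.2 ∈ B} :=
  ((hQ.contDiffOn_fderiv hB).clm_comp contDiffOn_const).congr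
    fun x hx => hQ.DzQ_eq hB x.1 x.2.1 hx

lemma hasFDerivAt_DuzQ (hQ : QoIAssumption B Q) (hB : IsOpen B) (v : U) (m : M) {z : Z}
    (hz : z ∈ B) : HasFDerivAt (fun v' => DzQ Q v' m z) (DuzQ Q v m z) v := by
  have h0 : DifferentiableAt ℝ (fun x : U × M × Z => DzQ Q x.1 x.2.1 x.2.2) (v, m, z) :=
    ((hQ.contDiffOn_DzQ hB).differentiableOn one_ne_zero).differentiableAt
      ((isOpen_third hB).mem_nhds hz)
  have h := h0.hasFDerivAt.comp (f := fun v' => (v', m, z)) v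
    ((hasFDerivAt_id v).prodMk (hasFDerivAt_const (m, z) v))
  exact h.differentiableAt.hasFDerivAt

/-- Polynomial growth of the quantity of interest and of its partial derivatives, with one
constant. -/
theorem exists_growth (hQ : QoIAssumption B Q) (hB : IsOpen B) :
    ∃ A ≥ 0, ∀ (m : M), ∀ z ∈ B,
      (∀ v, |Q v m z| ≤ A * (1 + ‖v‖) ^ 2) ∧
      (∀ v, ‖DuQ Q v m z‖ ≤ A * (1 + ‖v‖)) ∧
      (∀ v, ‖DzQ Q v m z‖ ≤ A * (1 + ‖v‖) ^ 2) ∧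
      (∀ v w, ‖DuQ Q v m z - DuQ Q w m z‖ ≤ A * ‖v - w‖) ∧
      (∀ v w, ‖DzQ Q v m z - DzQ Q w m z‖ ≤ A * (1 + ‖v‖ + ‖w‖) * ‖v - w‖) := by
  obtain ⟨κ, hκ, h1⟩ := hQ.lipschitz_DuQ
  obtain ⟨κ', hκ', h2⟩ := hQ.lipschitz_DuzQ
  obtain ⟨C, hC, h3⟩ := hQ.bound_Q
  obtain ⟨C₁, hC₁, h4⟩ := hQ.bound_DuQ
  obtain ⟨C₂, hC₂, h5⟩ := hQ.bound_DzQ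
  obtain ⟨C₃, hC₃, h6⟩ := hQ.bound_DuzQ
  refine ⟨κ + κ' + C + C₁ + C₂ + C₃, by positivity, fun m z hz => ?_⟩
  set A := κ + κ' + C + C₁ + C₂ + C₃ with hA
  have hu : ∀ v, ‖DuQ Q v m z‖ ≤ C₁ + κ * ‖v‖ := by
    intro v
    have a := h1 0 v m z hz
    rw [sub_zero] at a
    have b := norm_sub_norm_le (DuQ Q v m z) (DuQ Q 0 m z)
    linarith [h4 m z hz]
  have huz : ∀ v, ‖DuzQ Q v m z‖ ≤ C₃ + κ' * ‖v‖ := by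
    intro v
    have a := h2 0 v m z hz
    rw [sub_zero] at a
    have b := norm_sub_norm_le (DuzQ Q v m z) (DuzQ Q 0 m z)
    linarith [h6 m z hz]
  -- Mean value inequality in a ball that contains both `v` and `w`, with the linear growth of
  -- `DuzQ`.
  have hz' : ∀ v w, ‖DzQ Q v m z - DzQ Q w m z‖ ≤ (C₃ + κ' * (‖v‖ + ‖w‖)) * ‖v - w‖ := by
    intro v w
    refine (convex_closedBall (0 : U) (‖v‖ + ‖w‖)).norm_image_sub_le_of_norm_hasFDerivWithin_le
      (f := fun v' => DzQ Q v' m z)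
      (fun y _ => (hQ.hasFDerivAt_DuzQ hB y m hz).hasFDerivWithinAt) (fun y hy => ?_)
      (by simp) (by simp)
    have : ‖y‖ ≤ ‖v‖ + ‖w‖ := by simpa using hy
    exact (huz y).trans (by gcongr)
  have hq : ∀ v, |Q v m z| ≤ C + (C₁ + κ * ‖v‖) * ‖v‖ := by
    intro v
    have a := (convex_closedBall (0 : U) ‖v‖).norm_image_sub_le_of_norm_hasFDerivWithin_le
      (f := fun v' => Q v' m z) (x := 0) (y := v) (C := C₁ + κ * ‖v‖)
      (fun y _ => (hQ.hasFDerivAt_DuQ hB y m hz).hasFDerivWithinAt) (fun y hy => ?_)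
      (by simp) (by simp)
    · rw [sub_zero, Real.norm_eq_abs] at a
      have b := abs_sub_abs_le_abs_sub (Q v m z) (Q 0 m z)
      linarith [h3 m z hz]
    · have : ‖y‖ ≤ ‖v‖ := by simpa using hy
      exact (hu y).trans (by gcongr)
  have hA1 : C₁ ≤ A := by rw [hA]; linarith
  have hA2 : κ ≤ A := by rw [hA]; linarith
  have hA3 : C₃ ≤ A := by rw [hA]; linarith
  have hA4 : κ' ≤ A := by rw [hA]; linarith
  have hA0 : 0 ≤ A := by positivity
  refine ⟨fun v => ?_, fun v => ?_, fun v => ?_, fun v w => ?_, fun v w => ?_⟩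
  · have hn := norm_nonneg v
    refine (hq v).trans ?_
    calc C + (C₁ + κ * ‖v‖) * ‖v‖ = C + C₁ * ‖v‖ + κ * ‖v‖ ^ 2 := by ring
      _ ≤ A + A * ‖v‖ + A * ‖v‖ ^ 2 := by
        gcongr
        rw [hA]; linarith
      _ ≤ A * (1 + ‖v‖) ^ 2 := by nlinarith [mul_nonneg hA0 hn]
  · have hn := norm_nonneg v
    calc _ ≤ C₁ + κ * ‖v‖ := hu v
      _ ≤ A + A * ‖v‖ := by gcongr
      _ = A * (1 + ‖v‖) := by ring
  · have hn := norm_nonneg v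
    have a := hz' v 0
    rw [norm_zero, sub_zero, add_zero] at a
    have b := norm_sub_norm_le (DzQ Q v m z) (DzQ Q 0 m z)
    calc ‖DzQ Q v m z‖ ≤ C₂ + C₃ * ‖v‖ + κ' * ‖v‖ ^ 2 := by nlinarith [h5 m z hz]
      _ ≤ A + A * ‖v‖ + A * ‖v‖ ^ 2 := by
        gcongr
        rw [hA]; linarith
      _ ≤ A * (1 + ‖v‖) ^ 2 := by nlinarith [mul_nonneg hA0 hn]
  · exact (h1 w v m z hz).trans (by gcongr)
  · refine (hz' v w).trans ?_
    gcongr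
    have : κ' * (‖v‖ + ‖w‖) ≤ A * (‖v‖ + ‖w‖) := by gcongr
    linarith

end QoIAssumption

end Growth

/-! ### Differentiation of the mean objective -/

section Differentiation

open Filter Topology

variable {U M Z : Type*} [NormedAddCommGroup U] [InnerProductSpace ℝ U]
  [NormedAddCommGroup M] [InnerProductSpace ℝ M] [NormedAddCommGroup Z] [InnerProductSpace ℝ Z]
  {B : Set Z} {Q : U → M → Z → ℝ} {v : M → Z → U}

/-- Solution operators for which the mean objective can be differentiated under the integral. -/
structure IsRegularOperator (B : Set Z) (v : M → Z → U) : Prop where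
  contDiff : ContDiffOn ℝ 1 (fun x : M × Z => v x.1 x.2) {x | x.2 ∈ B}
  bound : ∀ z₀ ∈ B, ∃ δ > 0, Metric.ball z₀ δ ⊆ B ∧ ∃ C ≥ 0, ∀ m, ∀ z ∈ Metric.ball z₀ δ,
    ‖v m z‖ ≤ C * (1 + ‖m‖) ∧ ‖Dz v m z‖ ≤ C

/-- The derivative in `z` of `Q(v(m, z), m, z)`. -/
noncomputable def totalDz (Q : U → M → Z → ℝ) (v : M → Z → U) (m : M) (z : Z) : Z →L[ℝ] ℝ :=
  (DuQ Q (v m z) m z).comp (Dz v m z) + DzQ Q (v m z) m z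

omit [InnerProductSpace ℝ M] [InnerProductSpace ℝ Z] in
lemma isOpen_second (hB : IsOpen B) : IsOpen {x : M × Z | x.2 ∈ B} := hB.preimage (by fun_prop)

lemma hasFDerivAt_of_contDiffOn (hv : ContDiffOn ℝ 1 (fun x : M × Z => v x.1 x.2) {x | x.2 ∈ B})
    (hB : IsOpen B) (m : M) {z : Z} (hz : z ∈ B) :
    HasFDerivAt (fun z' => v m z')
      ((fderiv ℝ (fun x : M × Z => v x.1 x.2) (m, z)).comp (ContinuousLinearMap.inr ℝ M Z)) z := by
  have h0 : DifferentiableAt ℝ (fun x : M × Z => v x.1 x.2) (m, z) :=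
    (hv.differentiableOn one_ne_zero).differentiableAt ((isOpen_second hB).mem_nhds hz)
  exact h0.hasFDerivAt.comp (f := fun z' => (m, z')) z
    ((hasFDerivAt_const m z).prodMk (hasFDerivAt_id z))

namespace IsRegularOperator

lemma hasFDerivAt (hv : IsRegularOperator B v) (hB : IsOpen B) (m : M) {z : Z} (hz : z ∈ B) :
    HasFDerivAt (fun z' => v m z') (Dz v m z) z :=
  (hasFDerivAt_of_contDiffOn hv.contDiff hB m hz).differentiableAt.hasFDerivAt

lemma continuousOn_Dz (hv : IsRegularOperator B v) (hB : IsOpen B) :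
    ContinuousOn (fun x : M × Z => Dz v x.1 x.2) {x | x.2 ∈ B} := by
  refine ((hv.contDiff.continuousOn_fderiv_of_isOpen (isOpen_second hB) le_rfl).clm_comp
    (continuousOn_const (c := ContinuousLinearMap.inr ℝ M Z))).congr fun x hx => ?_
  exact (hasFDerivAt_of_contDiffOn hv.contDiff hB x.1 hx).fderiv

lemma continuousOn_graph (hv : IsRegularOperator B v) :
    ContinuousOn (fun x : M × Z => (v x.1 x.2, x.1, x.2)) {x | x.2 ∈ B} :=
  hv.contDiff.continuousOn.prodMk (by fun_prop)

lemma continuousOn_comp (hv : IsRegularOperator B v) (hQ : QoIAssumption B Q) :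
    ContinuousOn (fun x : M × Z => Q (v x.1 x.2) x.1 x.2) {x | x.2 ∈ B} :=
  hQ.contDiff.continuousOn.comp hv.continuousOn_graph fun _ hx => hx

lemma continuousOn_totalDz (hv : IsRegularOperator B v) (hQ : QoIAssumption B Q)
    (hB : IsOpen B) : ContinuousOn (fun x : M × Z => totalDz Q v x.1 x.2) {x | x.2 ∈ B} :=
  (((hQ.continuousOn_DuQ hB).comp hv.continuousOn_graph fun _ hx => hx).clm_comp
    (hv.continuousOn_Dz hB)).add
    ((hQ.contDiffOn_DzQ hB).continuousOn.comp hv.continuousOn_graph fun _ hx => hx)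

lemma hasFDerivAt_totalDz (hv : IsRegularOperator B v) (hQ : QoIAssumption B Q)
    (hB : IsOpen B) (m : M) {z : Z} (hz : z ∈ B) :
    HasFDerivAt (fun z' => Q (v m z') m z') (totalDz Q v m z) z := by
  have h := (hQ.hasFDerivAt hB (v m z) m hz).comp (f := fun z' => (v m z', m, z')) z
    ((hv.hasFDerivAt hB m hz).prodMk ((hasFDerivAt_const m z).prodMk (hasFDerivAt_id z)))
  refine h.congr_fderiv ?_
  rw [totalDz, hQ.DuQ_eq hB _ _ hz, hQ.DzQ_eq hB _ _ hz]
  ext w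
  simp only [ContinuousLinearMap.comp_apply, ContinuousLinearMap.prod_apply, add_apply,
    ContinuousLinearMap.inl_apply, ContinuousLinearMap.inr_apply, ← map_add]
  simp

/-- Local domination of the integrand and of its derivative. -/
lemma exists_bound (hv : IsRegularOperator B v) (hQ : QoIAssumption B Q) (hB : IsOpen B)
    {z₀ : Z} (hz₀ : z₀ ∈ B) : ∃ δ > 0, Metric.ball z₀ δ ⊆ B ∧ ∃ C, ∀ m, ∀ z ∈ Metric.ball z₀ δ,
      |Q (v m z) m z| ≤ C * (1 + ‖m‖) ^ 2 ∧ ‖totalDz Q v m z‖ ≤ C * (1 + ‖m‖) ^ 2 := by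
  obtain ⟨A, hA, hAQ⟩ := hQ.exists_growth hB
  obtain ⟨δ, hδ, hδB, C, hC, hCv⟩ := hv.bound z₀ hz₀
  -- Quadratic growth of `Q` composed with linear growth of `v`; the factor 2 counts the two
  -- summands of `totalDz`.
  refine ⟨δ, hδ, hδB, 2 * A * (1 + C) ^ 2, fun m z hz => ?_⟩
  obtain ⟨h1, h2, h3, -, -⟩ := hAQ m z (hδB hz)
  obtain ⟨c1, c2⟩ := hCv m z hz
  have hm := norm_nonneg m
  set W := 1 + ‖m‖ with hW
  have hW1 : 1 ≤ W := by linarith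
  have c3 : 1 + ‖v m z‖ ≤ (1 + C) * W := by nlinarith
  have c4 : (1 + ‖v m z‖) ^ 2 ≤ (1 + C) ^ 2 * W ^ 2 := by
    rw [← mul_pow]; gcongr
  have c5 : A * (1 + ‖v m z‖) ^ 2 ≤ A * ((1 + C) ^ 2 * W ^ 2) := by gcongr
  have c0 : 0 ≤ A * ((1 + C) ^ 2 * W ^ 2) := by positivity
  constructor
  · linarith [h1 (v m z)]
  · have b1 : ‖(DuQ Q (v m z) m z).comp (Dz v m z)‖ ≤ A * ((1 + C) ^ 2 * W ^ 2) := by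
      refine (ContinuousLinearMap.opNorm_comp_le _ _).trans ?_
      calc ‖DuQ Q (v m z) m z‖ * ‖Dz v m z‖ ≤ (A * ((1 + C) * W)) * C := by
            gcongr
            exact (h2 _).trans (by gcongr)
        _ ≤ (A * ((1 + C) * W)) * ((1 + C) * W) := by
            gcongr
            nlinarith
        _ = _ := by ring
    refine (norm_add_le _ _).trans ?_
    linarith [h3 (v m z)]

variable [MeasurableSpace M] [BorelSpace M] [TopologicalSpace.SeparableSpace M]
  {μ : Measure M}

omit [InnerProductSpace ℝ M] [InnerProductSpace ℝ Z] in
lemma aestronglyMeasurable_of_continuousOn {Y : Type*} [NormedAddCommGroup Y] {f : M → Z → Y}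
    (hf : ContinuousOn (fun x : M × Z => f x.1 x.2) {x | x.2 ∈ B}) {z : Z} (hz : z ∈ B) :
    AEStronglyMeasurable (fun m => f m z) μ := by
  have : SecondCountableTopology M := UniformSpace.secondCountable_of_separable M
  have h : Continuous fun m => f m z :=
    hf.comp_continuous (f := fun m => (m, z)) (by fun_prop) fun _ => hz
  exact h.aestronglyMeasurable

lemma integrable (hv : IsRegularOperator B v) (hQ : QoIAssumption B Q) (hB : IsOpen B)
    (hμ : Integrable (fun m => (1 + ‖m‖) ^ 2) μ) {z : Z} (hz : z ∈ B) :
    Integrable (fun m => Q (v m z) m z) μ := by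
  obtain ⟨δ, hδ, hδB, C, hC⟩ := hv.exists_bound hQ hB hz
  exact (hμ.const_mul C).mono' (aestronglyMeasurable_of_continuousOn
    (f := fun m z => Q (v m z) m z) (hv.continuousOn_comp hQ) hz)
    (.of_forall fun m => (hC m z (Metric.mem_ball_self hδ)).1)

lemma integrable_totalDz (hv : IsRegularOperator B v) (hQ : QoIAssumption B Q) (hB : IsOpen B)
    (hμ : Integrable (fun m => (1 + ‖m‖) ^ 2) μ) {z : Z} (hz : z ∈ B) :
    Integrable (fun m => totalDz Q v m z) μ := by
  obtain ⟨δ, hδ, hδB, C, hC⟩ := hv.exists_bound hQ hB hz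
  exact (hμ.const_mul C).mono' (aestronglyMeasurable_of_continuousOn
    (hv.continuousOn_totalDz hQ hB) hz)
    (.of_forall fun m => (hC m z (Metric.mem_ball_self hδ)).2)

lemma hasFDerivAt_integral (hv : IsRegularOperator B v) (hQ : QoIAssumption B Q) (hB : IsOpen B)
    (hμ : Integrable (fun m => (1 + ‖m‖) ^ 2) μ) {z : Z} (hz : z ∈ B) :
    HasFDerivAt (fun z => ∫ m, Q (v m z) m z ∂μ) (∫ m, totalDz Q v m z ∂μ) z := by
  obtain ⟨δ, hδ, hδB, C, hC⟩ := hv.exists_bound hQ hB hz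
  refine hasFDerivAt_integral_of_dominated_of_fderiv_le (s := Metric.ball z δ)
    (bound := fun m => C * (1 + ‖m‖) ^ 2)
    (Metric.ball_mem_nhds z hδ) ?_ (hv.integrable hQ hB hμ hz)
    (hv.integrable_totalDz hQ hB hμ hz).aestronglyMeasurable
    (.of_forall fun m z' hz' => (hC m z' hz').2) (hμ.const_mul C)
    (.of_forall fun m z' hz' => hv.hasFDerivAt_totalDz hQ hB m (hδB hz'))
  filter_upwards [Metric.ball_mem_nhds z hδ] with z' hz'
  exact (hv.integrable hQ hB hμ (hδB hz')).aestronglyMeasurable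

lemma contDiffOn_integral (hv : IsRegularOperator B v) (hQ : QoIAssumption B Q) (hB : IsOpen B)
    (hμ : Integrable (fun m => (1 + ‖m‖) ^ 2) μ) :
    ContDiffOn ℝ 1 (fun z => ∫ m, Q (v m z) m z ∂μ) B := by
  have hc : ContinuousOn (fun z => ∫ m, totalDz Q v m z ∂μ) B := by
    intro z hz
    refine ContinuousAt.continuousWithinAt ?_
    obtain ⟨δ, hδ, hδB, C, hC⟩ := hv.exists_bound hQ hB hz
    refine continuousAt_of_dominated (bound := fun m => C * (1 + ‖m‖) ^ 2) ?_ ?_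
      (hμ.const_mul C) (.of_forall fun m => ?_)
    · filter_upwards [Metric.ball_mem_nhds z hδ] with z' hz'
      exact (hv.integrable_totalDz hQ hB hμ (hδB hz')).aestronglyMeasurable
    · filter_upwards [Metric.ball_mem_nhds z hδ] with z' hz'
      exact .of_forall fun m => (hC m z' hz').2
    · have h := (hv.continuousOn_totalDz hQ hB).continuousAt
        (x := (m, z)) ((isOpen_second hB).mem_nhds hz)
      exact h.comp (f := fun z => (m, z)) (by fun_prop)
  have h1 : (1 : WithTop ℕ∞) = 0 + 1 := by simp
  rw [h1, contDiffOn_succ_iff_fderiv_of_isOpen hB]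
  refine ⟨fun z hz =>
    (hv.hasFDerivAt_integral hQ hB hμ hz).differentiableAt.differentiableWithinAt, by simp, ?_⟩
  rw [contDiffOn_zero]
  exact hc.congr fun z hz => (hv.hasFDerivAt_integral hQ hB hμ hz).fderiv

end IsRegularOperator

omit [NormedAddCommGroup M] [InnerProductSpace ℝ M] in
/-- Sensitivity of the derivative of the integrand to the solution operator. -/
lemma norm_totalDz_sub_le {A κ : ℝ} (hA : 0 ≤ A) (hκ : 0 ≤ κ) {w : M → Z → U} {m : M} {z : Z}
    (h2 : ∀ v, ‖DuQ Q v m z‖ ≤ A * (1 + ‖v‖))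
    (h4 : ∀ v w, ‖DuQ Q v m z - DuQ Q w m z‖ ≤ A * ‖v - w‖)
    (h5 : ∀ v w, ‖DzQ Q v m z - DzQ Q w m z‖ ≤ A * (1 + ‖v‖ + ‖w‖) * ‖v - w‖)
    (hv : ‖Dz v m z‖ ≤ κ) :
    ‖totalDz Q v m z - totalDz Q w m z‖ ≤
      A * (1 + κ) * (1 + ‖v m z‖ + ‖w m z‖) * (‖v m z - w m z‖ + ‖Dz v m z - Dz w m z‖) := by
  -- The splitting is arranged so that an a priori bound is needed for `Dz v` only, not for `Dz w`.
  have e : totalDz Q v m z - totalDz Q w m z =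
      (DuQ Q (v m z) m z - DuQ Q (w m z) m z).comp (Dz v m z) +
        (DuQ Q (w m z) m z).comp (Dz v m z - Dz w m z) +
        (DzQ Q (v m z) m z - DzQ Q (w m z) m z) := by
    simp only [totalDz, ContinuousLinearMap.sub_comp, ContinuousLinearMap.comp_sub]
    abel
  have b1 : ‖(DuQ Q (v m z) m z - DuQ Q (w m z) m z).comp (Dz v m z)‖ ≤
      A * ‖v m z - w m z‖ * κ :=
    (ContinuousLinearMap.opNorm_comp_le _ _).trans
      (mul_le_mul (h4 _ _) hv (norm_nonneg _) (by positivity))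
  have b2 : ‖(DuQ Q (w m z) m z).comp (Dz v m z - Dz w m z)‖ ≤
      A * (1 + ‖w m z‖) * ‖Dz v m z - Dz w m z‖ :=
    (ContinuousLinearMap.opNorm_comp_le _ _).trans
      (mul_le_mul_of_nonneg_right (h2 _) (norm_nonneg _))
  rw [e]
  refine (norm_add₃_le).trans ((add_le_add (add_le_add b1 b2) (h5 _ _)).trans ?_)
  have p1 := norm_nonneg (v m z)
  have p2 := norm_nonneg (w m z)
  have p3 := norm_nonneg (v m z - w m z)
  have p4 := norm_nonneg (Dz v m z - Dz w m z)
  set a := ‖v m z‖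
  set b := ‖w m z‖
  set s := ‖v m z - w m z‖
  set t := ‖Dz v m z - Dz w m z‖
  -- This is exactly the difference of the two sides.
  have q : 0 ≤ A * κ * s * (a + b) + A * t * a + A * κ * (1 + a + b) * t := by positivity
  nlinarith

end Differentiation

/-! ### Truncation of the parameter -/

section Truncation

open Filter Topology

variable {M : Type*} [NormedAddCommGroup M] [InnerProductSpace ℝ M] {N : ℕ∞}

/-- The truncated coefficients of `m - b`. -/
noncomputable def truncCoeff (ψ : HilbertBasis (BasisIndex N) ℝ M) (b : M) (r : ℕ) (R : ℝ) (m : M) :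
    Fin (cappedRank N r) → ℝ :=
  fun i => trunc R (encode ψ (cappedRank_le N r) (m - b) i)

/-- The distance from `m` to its truncation in the affine span of the first basis vectors. -/
noncomputable def truncError (ψ : HilbertBasis (BasisIndex N) ℝ M) (b : M) (r : ℕ) (R : ℝ)
    (m : M) : ℝ :=
  ‖m - (b + decode ψ (cappedRank_le N r) (truncCoeff ψ b r R m))‖

/-- The contribution of the truncation of the coefficients. -/
noncomputable def coeffError (ψ : HilbertBasis (BasisIndex N) ℝ M) (b : M) (r : ℕ) (R : ℝ)
    (m : M) : ℝ :=
  ‖decode ψ (cappedRank_le N r) (fun i => truncCoeff ψ b r R m i -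
    encode ψ (cappedRank_le N r) (m - b) i)‖

variable (ψ : HilbertBasis (BasisIndex N) ℝ M) (b : M) (r : ℕ) (R : ℝ)

lemma truncError_le (m : M) :
    truncError ψ b r R m ≤ residual ψ r (m - b) + coeffError ψ b r R m := by
  rw [truncError, residual, coeffError, decode_sub]
  have e : m - (b + decode ψ (cappedRank_le N r) (truncCoeff ψ b r R m)) =
      (m - b - decode ψ (cappedRank_le N r) (encode ψ (cappedRank_le N r) (m - b))) -
      (decode ψ (cappedRank_le N r) (truncCoeff ψ b r R m) -
        decode ψ (cappedRank_le N r) (encode ψ (cappedRank_le N r) (m - b))) := by abel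
  rw [e]
  exact norm_sub_le _ _

/-- The coordinatewise factor 5 passes to norms by orthonormality, and the projection at most
doubles the norm in the crude bound used. The result is uniform in `r` and `R`. -/
lemma coeffError_le (m : M) : coeffError ψ b r R m ≤ 10 * ‖m - b‖ := by
  refine (norm_decode_le ψ _ (C := 5) (by norm_num) fun i => abs_trunc_sub_self_le R _).trans ?_
  have := norm_decode_encode_le ψ r (m - b)
  change 5 * ‖decode ψ (cappedRank_le N r) (encode ψ (cappedRank_le N r) (m - b))‖ ≤ _
  linarith

omit [InnerProductSpace ℝ M] in
lemma norm_sub_le_weight (m : M) : ‖m - b‖ ≤ (1 + ‖b‖) * (1 + ‖m‖) := by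
  have := norm_sub_le m b
  nlinarith [norm_nonneg m, norm_nonneg b, mul_nonneg (norm_nonneg m) (norm_nonneg b)]

lemma truncError_le_weight (m : M) : truncError ψ b r R m ≤ 11 * (1 + ‖b‖) * (1 + ‖m‖) := by
  have h1 := truncError_le ψ b r R m
  have h2 := coeffError_le ψ b r R m
  have h3 := residual_le ψ r (m - b)
  have h4 := norm_sub_le_weight b m
  linarith

lemma continuous_truncCoeff : Continuous (truncCoeff ψ b r R) := by
  refine continuous_pi fun i => (contDiff_trunc R).continuous.comp ?_
  exact (continuous_apply i).comp ((continuous_encode ψ _).comp (by fun_prop))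

lemma continuous_truncError : Continuous (truncError ψ b r R) := by
  unfold truncError
  exact (continuous_id.sub (continuous_const.add
    ((contDiff_decode ψ _).continuous.comp (continuous_truncCoeff ψ b r R)))).norm

lemma continuous_coeffError : Continuous (coeffError ψ b r R) := by
  unfold coeffError
  refine ((contDiff_decode ψ _).continuous.comp (continuous_pi fun i => ?_)).norm
  exact ((continuous_apply i).comp (continuous_truncCoeff ψ b r R)).sub
    ((continuous_apply i).comp ((continuous_encode ψ _).comp (by fun_prop)))

lemma tendsto_coeffError (m : M) :
    Tendsto (fun R => coeffError ψ b r R m) atTop (𝓝 0) := by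
  have h : Tendsto (fun R => fun i => truncCoeff ψ b r R m i -
      encode ψ (cappedRank_le N r) (m - b) i) atTop (𝓝 fun _ => 0) := by
    refine tendsto_pi_nhds.2 fun i => ?_
    have := (tendsto_trunc (encode ψ (cappedRank_le N r) (m - b) i)).sub_const
      (encode ψ (cappedRank_le N r) (m - b) i)
    rwa [sub_self] at this
  have h2 := ((contDiff_decode ψ (cappedRank_le N r)).continuous.norm.tendsto _).comp h
  have h0 : decode ψ (cappedRank_le N r) (fun _ => 0) = 0 := by simp [decode]
  rw [h0, norm_zero] at h2
  exact h2

variable [MeasurableSpace M] [BorelSpace M] {μ : Measure M}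

omit [InnerProductSpace ℝ M] in
lemma integrable_weight_mul (hμ : Integrable (fun m : M => (1 + ‖m‖) ^ 2) μ) {f : M → ℝ}
    (hf : Continuous f) {C : ℝ} (hC : ∀ m, |f m| ≤ C * (1 + ‖m‖)) :
    Integrable (fun m => (1 + ‖m‖) * f m) μ := by
  refine (hμ.const_mul C).mono' (by fun_prop) (.of_forall fun m => ?_)
  have h0 : 0 ≤ 1 + ‖m‖ := by positivity
  rw [Real.norm_eq_abs, abs_mul, abs_of_nonneg h0]
  nlinarith [hC m]

omit [InnerProductSpace ℝ M] in
-- Linear growth against a linear weight is dominated by the integrable `(1 + ‖m‖) ^ 2`.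
lemma tendsto_integral_weight_mul {ι : Type*} {l : Filter ι} [l.IsCountablyGenerated]
    (hμ : Integrable (fun m : M => (1 + ‖m‖) ^ 2) μ) {f : ι → M → ℝ}
    (hf : ∀ i, Continuous (f i)) {C : ℝ} (hC : ∀ i m, |f i m| ≤ C * (1 + ‖m‖))
    (hlim : ∀ m, Tendsto (fun i => f i m) l (𝓝 0)) :
    Tendsto (fun i => ∫ m, (1 + ‖m‖) * f i m ∂μ) l (𝓝 0) := by
  have h := tendsto_integral_filter_of_dominated_convergence (μ := μ) (l := l)
    (F := fun i m => (1 + ‖m‖) * f i m) (f := fun _ => 0) (fun m => C * (1 + ‖m‖) ^ 2)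
    (.of_forall fun i => (integrable_weight_mul hμ (hf i) (hC i)).aestronglyMeasurable)
    (.of_forall fun i => .of_forall fun m => ?_) (hμ.const_mul C)
    (.of_forall fun m => by simpa using (hlim m).const_mul (1 + ‖m‖))
  · simpa using h
  · have h0 : 0 ≤ 1 + ‖m‖ := by positivity
    rw [Real.norm_eq_abs, abs_mul, abs_of_nonneg h0]
    nlinarith [hC i m]

/-- The weighted mean truncation error can be made arbitrarily small. -/
theorem exists_integral_truncError_le (hμ : Integrable (fun m : M => (1 + ‖m‖) ^ 2) μ) {δ : ℝ}
    (hδ : 0 < δ) : ∃ (r : ℕ) (R : ℝ), 0 ≤ R ∧ ∫ m, (1 + ‖m‖) * truncError ψ b r R m ∂μ ≤ δ := by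
  have hc1 : ∀ r, Continuous fun m => residual ψ r (m - b) := fun r =>
    (continuous_residual ψ r).comp (by fun_prop)
  have hb1 : ∀ (r : ℕ) (m : M), |residual ψ r (m - b)| ≤ (1 + ‖b‖) * (1 + ‖m‖) := by
    intro r m
    rw [abs_of_nonneg (show 0 ≤ residual ψ r (m - b) from norm_nonneg _)]
    exact (residual_le ψ r _).trans (norm_sub_le_weight b m)
  have hb2 : ∀ (r : ℕ) (R : ℝ) (m : M),
      |coeffError ψ b r R m| ≤ 10 * (1 + ‖b‖) * (1 + ‖m‖) := by
    intro r R m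
    rw [abs_of_nonneg (show 0 ≤ coeffError ψ b r R m from norm_nonneg _)]
    have := coeffError_le ψ b r R m
    linarith [norm_sub_le_weight b m]
  have h1 := tendsto_integral_weight_mul (μ := μ) hμ hc1 hb1 fun m => tendsto_residual ψ (m - b)
  obtain ⟨r, hr⟩ := (h1.eventually (ge_mem_nhds (half_pos hδ))).exists
  -- The rank is already fixed: convergence in the height `R` is used for a fixed number of
  -- coefficients.
  have h2 := tendsto_integral_weight_mul (μ := μ) hμ (continuous_coeffError ψ b r) (hb2 r)
    (tendsto_coeffError ψ b r)
  obtain ⟨R, hR, hR0⟩ := ((h2.eventually (ge_mem_nhds (half_pos hδ))).and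
    (eventually_ge_atTop 0)).exists
  refine ⟨r, R, hR0, ?_⟩
  have i1 := integrable_weight_mul (μ := μ) hμ (hc1 r) (hb1 r)
  have i2 := integrable_weight_mul (μ := μ) hμ (continuous_coeffError ψ b r R) (hb2 r R)
  have i3 := integrable_weight_mul (μ := μ) hμ (continuous_truncError ψ b r R)
    (C := 11 * (1 + ‖b‖)) fun m => by
      rw [abs_of_nonneg (show 0 ≤ truncError ψ b r R m from norm_nonneg _)]
      exact truncError_le_weight ψ b r R m
  calc ∫ m, (1 + ‖m‖) * truncError ψ b r R m ∂μ
      ≤ ∫ m, ((1 + ‖m‖) * residual ψ r (m - b) + (1 + ‖m‖) * coeffError ψ b r R m) ∂μ := by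
        refine integral_mono i3 (i1.add i2) fun m => ?_
        have h0 : 0 ≤ 1 + ‖m‖ := by positivity
        have := mul_le_mul_of_nonneg_left (truncError_le ψ b r R m) h0
        simp only
        linarith
    _ = _ := integral_add i1 i2
    _ ≤ δ := by linarith

end Truncation

/-! ### Surrogate operators -/

section Surrogate

open Filter Topology

variable {U M : Type*} [NormedAddCommGroup U] [InnerProductSpace ℝ U]
  [NormedAddCommGroup M] [InnerProductSpace ℝ M] {d : ℕ} {NU NM : ℕ∞}
  {B : Set (Design d)} {u : M → Design d → U}

/-- Concatenation of reduced parameters and design variables, as a continuous linear map. -/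
noncomputable def concat (r d : ℕ) : ((Fin r → ℝ) × Design d) →L[ℝ] (Fin (r + d) → ℝ) :=
  ContinuousLinearMap.pi (Fin.addCases
    (fun i => (ContinuousLinearMap.proj i).comp (ContinuousLinearMap.fst ℝ _ _))
    (fun j => (EuclideanSpace.proj j).comp (ContinuousLinearMap.snd ℝ _ _)))

lemma concat_apply (r d : ℕ) (x : Fin r → ℝ) (z : Design d) :
    concat r d (x, z) = Fin.append x (fun j => z j) := by
  ext i
  refine Fin.addCases (fun i => ?_) (fun i => ?_) i <;> simp [concat]

/-- The reduced parameters in a concatenated vector. -/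
noncomputable def paramPart (r d : ℕ) : (Fin (r + d) → ℝ) →L[ℝ] (Fin r → ℝ) :=
  ContinuousLinearMap.pi fun i => ContinuousLinearMap.proj (Fin.castAdd d i)

/-- The design variables in a concatenated vector. -/
noncomputable def designPart (r d : ℕ) : (Fin (r + d) → ℝ) →L[ℝ] Design d :=
  ((EuclideanSpace.equiv (Fin d) ℝ).symm : (Fin d → ℝ) →L[ℝ] Design d).comp
    (ContinuousLinearMap.pi fun j => ContinuousLinearMap.proj (Fin.natAdd r j))

lemma paramPart_concat (r d : ℕ) (x : Fin r → ℝ) (z : Design d) :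
    paramPart r d (concat r d (x, z)) = x := by
  ext i; simp [concat_apply, paramPart]

lemma designPart_concat (r d : ℕ) (x : Fin r → ℝ) (z : Design d) :
    designPart r d (concat r d (x, z)) = z := by
  ext i; simp [concat_apply, designPart]

/-- The embedding of the design variables. -/
noncomputable abbrev designEmbedding (r d : ℕ) : Design d →L[ℝ] (Fin (r + d) → ℝ) :=
  (concat r d).comp (ContinuousLinearMap.inr ℝ _ _)

lemma hasFDerivAt_concat (r : ℕ) (x : Fin r → ℝ) (z : Design d) :
    HasFDerivAt (fun z => concat r d (x, z)) (designEmbedding r d) z :=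
  (concat r d).hasFDerivAt.comp (f := fun z => (x, z)) z
    ((hasFDerivAt_const x z).prodMk (hasFDerivAt_id z))

/-- Cauchy–Schwarz in the coordinates of the argument. -/
lemma norm_le_hsNorm (A : Design d →L[ℝ] U) : ‖A‖ ≤ hsNorm A := by
  refine A.opNorm_le_bound (Real.sqrt_nonneg _) fun v => ?_
  have h : A v = ∑ j, v j • A (EuclideanSpace.single j (1 : ℝ)) := by
    have hv : v = ∑ j, v j • EuclideanSpace.single j (1 : ℝ) := by
      ext i
      simp [Finset.sum_apply, Pi.single_apply]
    conv_lhs => rw [hv]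
    simp [map_sum]
  rw [h]
  refine (norm_sum_le _ _).trans ?_
  simp only [norm_smul]
  refine (Real.sum_mul_le_sqrt_mul_sqrt _ _ _).trans ?_
  rw [mul_comm, ← EuclideanSpace.norm_eq]
  rfl

omit [InnerProductSpace ℝ M] in
lemma norm_Dz_le {κ : ℝ} (hκ : 0 ≤ κ) (hB : IsOpen B)
    (h : ∀ m₁ m₂ : M, ∀ z₁ ∈ B, ∀ z₂ ∈ B, ‖u m₂ z₂ - u m₁ z₁‖ ≤ κ * (‖m₂ - m₁‖ + ‖z₂ - z₁‖))
    (m : M) {z : Design d} (hz : z ∈ B) : ‖Dz u m z‖ ≤ κ := by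
  refine norm_fderiv_le_of_lip' ℝ hκ ?_
  filter_upwards [hB.mem_nhds hz] with z' hz'
  simpa using h m m z hz z' hz'

omit [InnerProductSpace ℝ U] [InnerProductSpace ℝ M] in
lemma norm_le_weight {κ D : ℝ} (hκ : 0 ≤ κ) (hD : 0 ≤ D)
    (h : ∀ m₁ m₂ : M, ∀ z₁ ∈ B, ∀ z₂ ∈ B, ‖u m₂ z₂ - u m₁ z₁‖ ≤ κ * (‖m₂ - m₁‖ + ‖z₂ - z₁‖))
    {z₀ z : Design d} (hz₀ : z₀ ∈ B) (hz : z ∈ B) (hzD : ‖z - z₀‖ ≤ D) (m : M) :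
    ‖u m z‖ ≤ (‖u 0 z₀‖ + κ * (1 + D)) * (1 + ‖m‖) := by
  have h1 := h 0 m z₀ hz₀ z hz
  rw [sub_zero] at h1
  have h2 := norm_sub_norm_le (u m z) (u 0 z₀)
  have h3 : κ * (‖m‖ + ‖z - z₀‖) ≤ κ * (‖m‖ + D) := by gcongr
  have h4 : 0 ≤ ‖u 0 z₀‖ * ‖m‖ := by positivity
  have h5 : 0 ≤ κ * (1 + D * ‖m‖) := by positivity
  nlinarith

lemma SolutionAssumption.isRegularOperator (hu : SolutionAssumption B u) (hB : IsOpen B) :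
    IsRegularOperator B u := by
  obtain ⟨κ, hκ, h⟩ := hu.lipschitz
  refine ⟨hu.contDiff, fun z₀ hz₀ => ?_⟩
  obtain ⟨δ, hδ, hδB⟩ := Metric.isOpen_iff.1 hB z₀ hz₀
  refine ⟨δ, hδ, hδB, (‖u 0 z₀‖ + κ * (1 + δ)), by positivity, fun m z hz => ⟨?_, ?_⟩⟩
  · exact norm_le_weight hκ.le hδ.le h hz₀ (hδB hz)
      (by rw [← dist_eq_norm]; exact (Metric.mem_ball.1 hz).le) m
  · refine (norm_Dz_le hκ.le hB h m (hδB hz)).trans ?_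
    nlinarith [norm_nonneg (u 0 z₀), mul_pos hκ hδ]

/-- The surrogate operator obtained from a `C¹` map of truncated coefficients. -/
noncomputable def surrogate (ψ : HilbertBasis (BasisIndex NM) ℝ M) (bm : M) (r : ℕ) (R : ℝ)
    (H : (Fin (cappedRank NM r + d) → ℝ) → U) (bu : U) (m : M) (z : Design d) : U :=
  H (concat _ d (truncCoeff ψ bm r R m, z)) + bu

variable (ψ : HilbertBasis (BasisIndex NM) ℝ M) (bm : M) (r : ℕ) {R : ℝ}

lemma contDiff_truncCoeff : ContDiff ℝ 1 (truncCoeff ψ bm r R) := by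
  refine contDiff_pi.2 fun i => (contDiff_trunc R).comp ?_
  exact contDiff_pi.1 ((contDiff_encode ψ _).comp (contDiff_id.sub contDiff_const)) i

lemma truncCoeff_mem (hR : 0 ≤ R) (m : M) :
    truncCoeff ψ bm r R m ∈ Metric.closedBall (0 : Fin (cappedRank NM r) → ℝ) (R + 4) := by
  rw [mem_closedBall_zero_iff, pi_norm_le_iff_of_nonneg (by positivity)]
  exact fun i => abs_trunc_le hR _

/-- The reduced inputs over a set of design variables. -/
def reducedInputs (k : ℕ) (R : ℝ) (S : Set (Design d)) : Set (Fin (k + d) → ℝ) :=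
  concat k d '' (Metric.closedBall 0 (R + 4) ×ˢ S)

lemma isCompact_reducedInputs (k : ℕ) (R : ℝ) {S : Set (Design d)} (hS : IsCompact S) :
    IsCompact (reducedInputs k R S) :=
  ((isCompact_closedBall _ _).prod hS).image (concat k d).continuous

lemma mem_reducedInputs (hR : 0 ≤ R) (m : M) {S : Set (Design d)} {z : Design d} (hz : z ∈ S) :
    concat _ d (truncCoeff ψ bm r R m, z) ∈ reducedInputs (cappedRank NM r) R S :=
  ⟨_, ⟨truncCoeff_mem ψ bm r hR m, hz⟩, rfl⟩

lemma Dz_surrogate {H : (Fin (cappedRank NM r + d) → ℝ) → U} {bu : U} {m : M} {z : Design d}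
    (hH : DifferentiableAt ℝ H (concat _ d (truncCoeff ψ bm r R m, z))) :
    Dz (surrogate ψ bm r R H bu) m z =
      (fderiv ℝ H (concat _ d (truncCoeff ψ bm r R m, z))).comp (designEmbedding _ d) :=
  ((hH.hasFDerivAt.comp z (hasFDerivAt_concat _ _ z)).add_const bu).fderiv

/-- Truncation confines the inputs to a compact set, whatever `m` is; so `H` and its derivative are
bounded there without any growth condition on `H`. -/
lemma isRegularOperator_surrogate (hB : IsOpen B) (hR : 0 ≤ R)
    {H : (Fin (cappedRank NM r + d) → ℝ) → U} (hH : ContDiff ℝ 1 H) (bu : U) :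
    IsRegularOperator B (surrogate ψ bm r R H bu) := by
  refine ⟨?_, fun z₀ hz₀ => ?_⟩
  · refine ContDiff.contDiffOn ((hH.comp ((concat _ d).contDiff.comp ?_)).add contDiff_const)
    exact ((contDiff_truncCoeff ψ bm r).comp contDiff_fst).prodMk contDiff_snd
  · obtain ⟨δ, hδ, hδB⟩ := Metric.isOpen_iff.1 hB z₀ hz₀
    have hK := isCompact_reducedInputs (cappedRank NM r) R (isCompact_closedBall z₀ δ)
    obtain ⟨C₁, h₁⟩ := hK.exists_bound_of_continuousOn hH.continuous.continuousOn
    obtain ⟨C₂, h₂⟩ := hK.exists_bound_of_continuousOn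
      (hH.continuous_fderiv one_ne_zero).continuousOn
    refine ⟨δ, hδ, hδB, max (max (C₁ + ‖bu‖) (C₂ * ‖designEmbedding (cappedRank NM r) d‖)) 0,
      le_max_right _ _, fun m z hz => ?_⟩
    have hy := mem_reducedInputs ψ bm r hR m (Metric.ball_subset_closedBall hz)
    have hn := norm_nonneg m
    constructor
    · have h3 : ‖surrogate ψ bm r R H bu m z‖ ≤ C₁ + ‖bu‖ :=
        (norm_add_le _ _).trans (by gcongr; exact h₁ _ hy)
      have h4 := h3.trans ((le_max_left _
        (C₂ * ‖designEmbedding (cappedRank NM r) d‖)).trans (le_max_left _ 0))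
      exact h4.trans (le_mul_of_one_le_right (le_max_right _ _) (by linarith))
    · rw [Dz_surrogate ψ bm r (hH.differentiable one_ne_zero _)]
      refine (ContinuousLinearMap.opNorm_comp_le _ _).trans ?_
      refine le_trans ?_ ((le_max_right (C₁ + ‖bu‖) _).trans (le_max_left _ 0))
      gcongr
      exact h₂ _ hy

/-- The reduced solution map of which the networks are approximations. -/
noncomputable def reducedMap (u : M → Design d → U) (bu : U) (y : Fin (cappedRank NM r + d) → ℝ) :
    U :=
  u (bm + decode ψ (cappedRank_le NM r) (paramPart _ d y)) (designPart _ d y) - bu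

lemma contDiffOn_reducedMap
    (hu : ContDiffOn ℝ 1 (fun x : M × Design d => u x.1 x.2) {x | x.2 ∈ B}) (bu : U) :
    ContDiffOn ℝ 1 (reducedMap ψ bm r u bu) {y | designPart _ d y ∈ B} := by
  refine ContDiffOn.sub ?_ contDiffOn_const
  refine hu.comp (f := fun y => (bm + decode ψ (cappedRank_le NM r) (paramPart _ d y),
    designPart _ d y)) (ContDiff.contDiffOn ?_) fun y hy => hy
  exact (contDiff_const.add ((contDiff_decode ψ _).comp (paramPart _ d).contDiff)).prodMk
    (designPart _ d).contDiff

omit [InnerProductSpace ℝ U] in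
lemma reducedMap_concat (bu : U) (x : Fin (cappedRank NM r) → ℝ) (z : Design d) :
    reducedMap ψ bm r u bu (concat _ d (x, z)) + bu =
      u (bm + decode ψ (cappedRank_le NM r) x) z := by
  simp only [reducedMap, paramPart_concat, designPart_concat, sub_add_cancel]

/-- The surrogate inherits the error of the reduced map, up to the truncation error. -/
lemma surrogate_close (hu : SolutionAssumption B u) {κ κ' : ℝ} (hB : IsOpen B)
    (hκ : ∀ m₁ m₂ : M, ∀ z₁ ∈ B, ∀ z₂ ∈ B,
      ‖u m₂ z₂ - u m₁ z₁‖ ≤ κ * (‖m₂ - m₁‖ + ‖z₂ - z₁‖))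
    (hκ' : ∀ m₁ m₂ : M, ∀ z₁ ∈ B, ∀ z₂ ∈ B,
      hsNorm (Dz u m₂ z₂ - Dz u m₁ z₁) ≤ κ' * (‖m₂ - m₁‖ + ‖z₂ - z₁‖))
    {H : (Fin (cappedRank NM r + d) → ℝ) → U} (hH : ContDiff ℝ 1 H) {bu : U} {δ : ℝ} {m : M}
    {z : Design d} (hz : z ∈ B)
    (h₀ : ‖reducedMap ψ bm r u bu (concat _ d (truncCoeff ψ bm r R m, z)) -
      H (concat _ d (truncCoeff ψ bm r R m, z))‖ ≤ δ)
    (h₁ : ‖fderiv ℝ (reducedMap ψ bm r u bu) (concat _ d (truncCoeff ψ bm r R m, z)) -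
      fderiv ℝ H (concat _ d (truncCoeff ψ bm r R m, z))‖ * ‖designEmbedding (cappedRank NM r) d‖
        ≤ δ) :
    ‖u m z - surrogate ψ bm r R H bu m z‖ ≤ κ * truncError ψ bm r R m + δ ∧
      ‖Dz u m z - Dz (surrogate ψ bm r R H bu) m z‖ ≤ κ' * truncError ψ bm r R m + δ := by
  set y := concat _ d (truncCoeff ψ bm r R m, z) with hy
  -- Both errors are split at `m'`: the Lipschitz bounds of `u` carry `m` to `m'`, and the
  -- hypotheses on `H` apply at `m'`.
  set m' := bm + decode ψ (cappedRank_le NM r) (truncCoeff ψ bm r R m) with hm'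
  have hyB : y ∈ {y | designPart (cappedRank NM r) d y ∈ B} := by
    change designPart _ d y ∈ B
    rw [hy, designPart_concat]; exact hz
  have hO : IsOpen {y | designPart (cappedRank NM r) d y ∈ B} :=
    hB.preimage (designPart _ d).continuous
  constructor
  · have a := hκ m' m z hz z hz
    rw [sub_self, norm_zero, add_zero] at a
    refine (norm_sub_le_norm_sub_add_norm_sub _ (u m' z) _).trans (add_le_add a ?_)
    have e : u m' z = reducedMap ψ bm r u bu y + bu :=
      (reducedMap_concat ψ bm r bu (truncCoeff ψ bm r R m) z).symm
    rw [e, surrogate, add_sub_add_right_eq_sub]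
    exact h₀
  · have a := (norm_le_hsNorm _).trans (hκ' m' m z hz z hz)
    rw [sub_self, norm_zero, add_zero] at a
    refine (norm_sub_le_norm_sub_add_norm_sub _ (Dz u m' z) _).trans (add_le_add a ?_)
    have hd : DifferentiableAt ℝ (reducedMap ψ bm r u bu) y :=
      ((contDiffOn_reducedMap ψ bm r hu.contDiff bu).differentiableOn
        one_ne_zero).differentiableAt (hO.mem_nhds hyB)
    -- As a function of the design, `u m'` is the surrogate built from the reduced map itself.
    have e : Dz u m' z = (fderiv ℝ (reducedMap ψ bm r u bu) y).comp (designEmbedding _ d) := by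
      rw [← Dz_surrogate ψ bm r (bu := bu) hd]
      refine congrArg (fun f => fderiv ℝ f z) (funext fun z' => ?_)
      exact (reducedMap_concat ψ bm r bu _ z').symm
    rw [e, Dz_surrogate ψ bm r (hH.differentiable one_ne_zero _),
      ← ContinuousLinearMap.sub_comp]
    exact (ContinuousLinearMap.opNorm_comp_le _ _).trans h₁

/-- A decoded network of truncated coefficients is a reduced-basis neural operator. -/
lemma exists_rbno_eq_surrogate (φ : HilbertBasis (BasisIndex NU) ℝ U) (bu : U) (R : ℝ) {ru : ℕ}
    (hru : (ru : ℕ∞) ≤ NU) {G : (Fin (cappedRank NM r + d) → ℝ) → (Fin ru → ℝ)}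
    (hG : IsGeluNet G) : ∃ g : DenseNet (cappedRank NM r + d) ru, 1 ≤ g.depth ∧
      rbno φ ψ bu bm hru (cappedRank_le NM r) g =
        surrogate ψ bm r R (fun y => decode φ hru (G y)) bu := by
  -- Only the parameter coordinates are truncated; the design coordinates pass through exactly.
  have hT : IsGeluNet fun y : Fin (cappedRank NM r + d) → ℝ =>
      (Fin.append (fun i => trunc R (y (Fin.castAdd d i))) (fun j => y (Fin.natAdd _ j)) :
        Fin (cappedRank NM r + d) → ℝ) :=
    (IsGeluNet.pi fun i => (IsScalarNet.coord (Fin.castAdd d i)).trunc_comp R).append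
      (IsGeluNet.reindex (Fin.natAdd _))
  obtain ⟨g, hg, hge⟩ := (hG.comp hT).exists_denseNet_depth
  refine ⟨g, hg, ?_⟩
  funext m z
  simp only [rbno, surrogate, hge, concat_apply, Fin.append_left, Fin.append_right]
  rfl

end Surrogate

/-! ### Approximation of the gradient -/

section Gradient

variable {U M : Type*} [NormedAddCommGroup U] [InnerProductSpace ℝ U]
  [NormedAddCommGroup M] [InnerProductSpace ℝ M] [TopologicalSpace.SeparableSpace M]
  [MeasurableSpace M] [BorelSpace M] {d : ℕ} {NU NM : ℕ∞} {B Zad : Set (Design d)}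
  {u : M → Design d → U} {Q : U → M → Design d → ℝ} {μ : Measure M}

/-- There are reduced-basis neural operators for which the gradient of the mean objective is
uniformly close to the exact one on a compact set of designs. -/
theorem exists_rbno_gradient_close [IsProbabilityMeasure μ] (hB : IsOpen B)
    (hne : Zad.Nonempty) (hcompact : IsCompact Zad) (hsub : Zad ⊆ B)
    (hμ : Integrable (fun m => (1 + ‖m‖) ^ 2) μ)
    (hu : SolutionAssumption B u) (hQ : QoIAssumption B Q)
    (φ : HilbertBasis (BasisIndex NU) ℝ U) (ψ : HilbertBasis (BasisIndex NM) ℝ M)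
    (bu : U) (bm : M) {η : ℝ} (hη : 0 < η) :
    ∃ (ru rm : ℕ) (hru : (ru : ℕ∞) ≤ NU) (hrm : (rm : ℕ∞) ≤ NM) (g : DenseNet (rm + d) ru),
      1 ≤ g.depth ∧ IsRegularOperator B (rbno φ ψ bu bm hru hrm g) ∧
      ∀ z ∈ Zad, ‖(∫ m, totalDz Q (rbno φ ψ bu bm hru hrm g) m z ∂μ) -
        ∫ m, totalDz Q u m z ∂μ‖ ≤ η := by
  obtain ⟨A, hA, hAQ⟩ := hQ.exists_growth hB
  obtain ⟨κ, hκ, hLip⟩ := hu.lipschitz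
  obtain ⟨κ', hκ', hLip'⟩ := hu.lipschitz_Dz
  obtain ⟨z₀, hz₀⟩ := hne
  obtain ⟨D, hD, hZD⟩ : ∃ D ≥ 0, ∀ z ∈ Zad, ‖z - z₀‖ ≤ D :=
    ⟨Metric.diam Zad, Metric.diam_nonneg, fun z hz => by
      rw [← dist_eq_norm]; exact Metric.dist_le_diam_of_mem hcompact.isBounded hz hz₀⟩
  set Cu := ‖u 0 z₀‖ + κ * (1 + D) with hCu
  have hCu0 : 0 ≤ Cu := by positivity
  set C₀ := 11 * (1 + ‖bm‖) with hC₀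
  have hC₀0 : 0 ≤ C₀ := by positivity
  -- Bounds `1 + ‖u‖ + ‖s‖` relative to `1 + ‖m‖`, using `‖s‖ ≤ ‖u‖ + κ * truncError + δ` and `δ ≤
  -- 1`. Thus `C₁` and `C` do not depend on the tolerances, which are chosen afterwards from `C`.
  set C₁ := 2 + 2 * Cu + κ * C₀ with hC₁
  have hC₁0 : 0 ≤ C₁ := by positivity
  set C := A * (1 + κ) * C₁ * (κ + κ' + 2) with hC
  have hC0 : 0 ≤ C := by positivity
  have hW : Integrable (fun m : M => 1 + ‖m‖) μ := by
    refine hμ.mono' (by fun_prop) (.of_forall fun m => ?_)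
    rw [Real.norm_of_nonneg (by positivity)]
    nlinarith [norm_nonneg m]
  set w := ∫ m, (1 + ‖m‖) ∂μ with hw
  have hw0 : 0 ≤ w := integral_nonneg fun m => by positivity
  obtain ⟨r, R, hR, hrR⟩ := exists_integral_truncError_le ψ bm hμ
    (show 0 < η / (2 * (C + 1)) by positivity)
  set δ := min 1 (η / (2 * (C + 1) * (w + 1))) with hδ
  have hδ0 : 0 < δ := by positivity
  have hδ1 : δ ≤ 1 := min_le_left _ _
  have hδw : δ * w ≤ η / (2 * (C + 1)) := by
    calc δ * w ≤ η / (2 * (C + 1) * (w + 1)) * (w + 1) := by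
          gcongr
          · exact min_le_right _ _
          · linarith
      _ = η / (2 * (C + 1)) := by field_simp
  have hO : IsOpen {y | designPart (cappedRank NM r) d y ∈ B} :=
    hB.preimage (designPart _ d).continuous
  have hKO : reducedInputs (cappedRank NM r) R Zad ⊆
      {y | designPart (cappedRank NM r) d y ∈ B} := by
    rintro _ ⟨⟨x, z⟩, ⟨-, hz⟩, rfl⟩
    change designPart _ d (concat _ d (x, z)) ∈ B
    rw [designPart_concat]
    exact hsub hz
  -- The `z`-derivative of the surrogate is the derivative in all inputs composed with this
  -- embedding, so the network tolerance is `δ / (1 + l)`, fixed only after `r`.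
  set l := ‖designEmbedding (cappedRank NM r) d‖ with hl
  have hl0 : 0 ≤ l := norm_nonneg _
  obtain ⟨ru, hru, G, hG, hGc⟩ := exists_isGeluNet_decode_close φ hO
    (contDiffOn_reducedMap ψ bm r hu.contDiff bu) (isCompact_reducedInputs _ R hcompact) hKO
    (show 0 < δ / (1 + l) by positivity)
  have hδl : δ / (1 + l) ≤ δ := div_le_self hδ0.le (by linarith)
  have hδl' : δ / (1 + l) * l ≤ δ := by
    rw [div_mul_eq_mul_div, div_le_iff₀ (by positivity)]
    nlinarith
  have hH : ContDiff ℝ 1 fun y => decode φ hru (G y) := (contDiff_decode φ hru).comp hG.contDiff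
  obtain ⟨g, hg, hge⟩ := exists_rbno_eq_surrogate ψ bm r φ bu R hru hG
  have hreg := isRegularOperator_surrogate (B := B) ψ bm r hB hR hH bu
  refine ⟨ru, cappedRank NM r, hru, cappedRank_le NM r, g, hg, ?_⟩
  rw [hge]
  set s := surrogate ψ bm r R (fun y => decode φ hru (G y)) bu with hs
  refine ⟨hreg, fun z hz => ?_⟩
  have hzB := hsub hz
  have hpoint : ∀ m, ‖totalDz Q s m z - totalDz Q u m z‖ ≤
      C * ((1 + ‖m‖) * truncError ψ bm r R m + δ * (1 + ‖m‖)) := by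
    intro m
    obtain ⟨-, h2, -, h4, h5⟩ := hAQ m z hzB
    have hy := mem_reducedInputs ψ bm r hR m hz
    obtain ⟨a1, a2⟩ := hGc _ hy
    obtain ⟨b1, b2⟩ := surrogate_close ψ bm r (R := R) (m := m) (z := z) (δ := δ) (bu := bu)
      hu hB hLip hLip' hH hzB (a1.trans hδl)
      ((mul_le_mul_of_nonneg_right a2 hl0).trans hδl')
    have c1 := norm_le_weight hκ.le hD hLip (hsub hz₀) hzB (hZD z hz) m
    have c2 := truncError_le_weight ψ bm r R m
    have c3 := norm_sub_norm_le (s m z) (u m z)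
    rw [norm_sub_rev] at c3
    have hm := norm_nonneg m
    have ht : 0 ≤ truncError ψ bm r R m := norm_nonneg _
    set h := truncError ψ bm r R m
    have c4 : 1 + ‖u m z‖ + ‖s m z‖ ≤ C₁ * (1 + ‖m‖) := by
      have : κ * h ≤ κ * (C₀ * (1 + ‖m‖)) := by gcongr
      rw [hC₁]
      linarith
    have c5 : ‖u m z - s m z‖ + ‖Dz u m z - Dz s m z‖ ≤ (κ + κ' + 2) * (h + δ) := by
      have : 0 ≤ κ * δ + κ' * δ + 2 * h := by positivity
      linarith
    rw [norm_sub_rev]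
    refine (norm_totalDz_sub_le hA hκ.le h2 h4 h5 (norm_Dz_le hκ.le hB hLip m hzB)).trans ?_
    calc A * (1 + κ) * (1 + ‖u m z‖ + ‖s m z‖) * (‖u m z - s m z‖ + ‖Dz u m z - Dz s m z‖)
        ≤ A * (1 + κ) * (C₁ * (1 + ‖m‖)) * ((κ + κ' + 2) * (h + δ)) := by gcongr
      _ = C * ((1 + ‖m‖) * h + δ * (1 + ‖m‖)) := by rw [hC]; ring
  rw [← integral_sub (hreg.integrable_totalDz hQ hB hμ hzB)
    ((hu.isRegularOperator hB).integrable_totalDz hQ hB hμ hzB)]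
  have i1 : Integrable (fun m => (1 + ‖m‖) * truncError ψ bm r R m) μ :=
    integrable_weight_mul hμ (continuous_truncError ψ bm r R) (C := C₀) fun m => by
      rw [abs_of_nonneg (show 0 ≤ truncError ψ bm r R m from norm_nonneg _)]
      exact truncError_le_weight ψ bm r R m
  refine (norm_integral_le_of_norm_le ((i1.add (hW.const_mul δ)).const_mul C)
    (.of_forall hpoint)).trans ?_
  have e : ∫ m, C * ((1 + ‖m‖) * truncError ψ bm r R m + δ * (1 + ‖m‖)) ∂μ =
      C * ((∫ m, (1 + ‖m‖) * truncError ψ bm r R m ∂μ) + δ * w) := by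
    rw [integral_const_mul, integral_add i1 (hW.const_mul δ), integral_const_mul]
  refine e.le.trans ?_
  calc C * ((∫ m, (1 + ‖m‖) * truncError ψ bm r R m ∂μ) + δ * w)
      ≤ C * (η / (2 * (C + 1)) + η / (2 * (C + 1))) := by gcongr
    _ = η * (C / (C + 1)) := by field_simp; ring
    _ ≤ η * 1 := by
        gcongr
        rw [div_le_one (by positivity)]; linarith
    _ = η := mul_one η

end Gradient

/-! ### Stability of minimizers of strongly convex functions -/

section Optimization

variable {Z : Type*} [NormedAddCommGroup Z] [InnerProductSpace ℝ Z] {J Jθ : Z → ℝ} {Zad : Set Z}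
  {lam : ℝ}

/-- Quadratic growth at a constrained minimizer. -/
lemma quadratic_growth (hconvex : Convex ℝ Zad) {zs z : Z} (hzs : zs ∈ Zad) (hz : z ∈ Zad)
    (hmin : IsMinOn J Zad zs) (hd : DifferentiableAt ℝ J zs)
    (hsc : J zs + fderiv ℝ J zs (z - zs) + lam / 2 * ‖z - zs‖ ^ 2 ≤ J z) :
    J zs + lam / 2 * ‖z - zs‖ ^ 2 ≤ J z := by
  have h := hmin.localize.hasFDerivWithinAt_nonneg hd.hasFDerivAt.hasFDerivWithinAt
    (sub_mem_posTangentConeAt_of_segment_subset (hconvex.segment_subset hzs hz))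
  linarith

/-- A stationary point of a function whose gradient is close to that of a strongly convex function
is close to the minimizer of the latter. -/
lemma stationary_close (hlam : 0 < lam) {zs zd : Z} {η : ℝ} (hη : 0 ≤ η)
    (hgrowth : J zs + lam / 2 * ‖zd - zs‖ ^ 2 ≤ J zd)
    (hsc : J zd + fderiv ℝ J zd (zs - zd) + lam / 2 * ‖zs - zd‖ ^ 2 ≤ J zs)
    (hstat : 0 ≤ fderiv ℝ Jθ zd (zs - zd)) (hclose : ‖fderiv ℝ Jθ zd - fderiv ℝ J zd‖ ≤ η) :
    ‖zs - zd‖ ≤ η / lam ∧ J zd - J zs ≤ η ^ 2 / lam := by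
  have h1 : (fderiv ℝ Jθ zd - fderiv ℝ J zd) (zs - zd) ≤ η * ‖zs - zd‖ :=
    (le_abs_self _).trans (((fderiv ℝ Jθ zd - fderiv ℝ J zd).le_opNorm _).trans (by gcongr))
  rw [sub_apply] at h1
  rw [norm_sub_rev] at hgrowth
  have ht := norm_nonneg (zs - zd)
  set t := ‖zs - zd‖
  -- Sum of `hgrowth`, `hsc`, `hstat` and `h1`.
  have h2 : lam * t ^ 2 ≤ η * t := by linarith
  have h3 : t ≤ η / lam := by
    rw [le_div_iff₀ hlam]
    rcases ht.eq_or_lt with h | h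
    · rw [← h, zero_mul]; exact hη
    · nlinarith
  refine ⟨h3, ?_⟩
  have h4 : 0 ≤ lam / 2 * t ^ 2 := by positivity
  calc J zd - J zs ≤ η * t := by linarith
    _ ≤ η * (η / lam) := by gcongr
    _ = η ^ 2 / lam := by ring

end Optimization

/-- With `t = ‖m‖`: `(1 + t)²` is at most 4 for `t ≤ 1`, and at most `4 t² ≤ 4 t ^ p` for `t ≥ 1`.
-/
lemma integrable_weight_sq {M : Type*} [NormedAddCommGroup M] [MeasurableSpace M] [BorelSpace M]
    {μ : Measure M} [IsProbabilityMeasure μ] {p : ℝ} (hp : 2 ≤ p)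
    (hμ : Integrable (fun m => ‖m‖ ^ p) μ) : Integrable (fun m : M => (1 + ‖m‖) ^ 2) μ := by
  refine ((integrable_const (4 : ℝ)).add (hμ.const_mul 4)).mono' (by fun_prop)
    (.of_forall fun m => ?_)
  have hm := norm_nonneg m
  have hp0 : 0 ≤ ‖m‖ ^ p := by positivity
  rw [Real.norm_of_nonneg (by positivity)]
  change (1 + ‖m‖) ^ 2 ≤ 4 + 4 * ‖m‖ ^ p
  rcases le_total ‖m‖ 1 with h | h
  · nlinarith
  · have : ‖m‖ ^ 2 ≤ ‖m‖ ^ p := by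
      rw [← Real.rpow_natCast]
      exact Real.rpow_le_rpow_of_exponent_le h (by simpa using hp)
    nlinarith

end RBNO

theorem theorem3p2
    {U M : Type*}
    [NormedAddCommGroup U] [InnerProductSpace ℝ U] [CompleteSpace U]
    [TopologicalSpace.SeparableSpace U]
    [NormedAddCommGroup M] [InnerProductSpace ℝ M] [CompleteSpace M]
    [TopologicalSpace.SeparableSpace M]
    [MeasurableSpace M] [BorelSpace M]
    {d : ℕ}
    (μ : Measure M) [IsProbabilityMeasure μ]
    (p : ℝ) (hp : 2 ≤ p) (hμ : Integrable (fun m => ‖m‖ ^ p) μ)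
    (Zad B : Set (RBNO.Design d))
    (hne : Zad.Nonempty) (hcompact : IsCompact Zad) (hconvex : Convex ℝ Zad)
    (hB : IsOpen B) (hsub : Zad ⊆ B)
    (u : M → RBNO.Design d → U) (hu : RBNO.SolutionAssumption B u)
    (Q : U → M → RBNO.Design d → ℝ) (hQ : RBNO.QoIAssumption B Q)
    (P : RBNO.Design d → ℝ)
    (hJ : ContDiffOn ℝ 1 (RBNO.meanObjective μ Q P u) B)
    (hJconvex : RBNO.StronglyConvex B (RBNO.meanObjective μ Q P u))
    {NU NM : ℕ∞}
    (φ : HilbertBasis (RBNO.BasisIndex NU) ℝ U) (ψ : HilbertBasis (RBNO.BasisIndex NM) ℝ M)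
    (bu : U) (bm : M) :
    ∃ zs : RBNO.Design d,
      (zs ∈ Zad ∧ IsMinOn (RBNO.meanObjective μ Q P u) Zad zs) ∧
      (∀ z ∈ Zad, IsMinOn (RBNO.meanObjective μ Q P u) Zad z → z = zs) ∧
      ∀ ε : ℝ, 0 < ε →
        ∃ (ru rm : ℕ) (hru : (ru : ℕ∞) ≤ NU) (hrm : (rm : ℕ∞) ≤ NM)
          (g : RBNO.DenseNet (rm + d) ru),
          1 ≤ g.depth ∧
          (∀ z ∈ B, Integrable (fun m => Q (RBNO.rbno φ ψ bu bm hru hrm g m z) m z) μ) ∧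
          ContDiffOn ℝ 1 (RBNO.meanObjective μ Q P (RBNO.rbno φ ψ bu bm hru hrm g)) B ∧
          ∀ zd : RBNO.Design d,
            RBNO.IsStationary Zad
              (RBNO.meanObjective μ Q P (RBNO.rbno φ ψ bu bm hru hrm g)) zd →
            ‖zs - zd‖ ≤ ε ∧
              RBNO.meanObjective μ Q P u zd - RBNO.meanObjective μ Q P u zs ≤ ε ^ 2 := by
  open RBNO in
  have hW := integrable_weight_sq hp hμ
  have hru := hu.isRegularOperator hB
  obtain ⟨lam, hlam, hsc⟩ := hJconvex
  have hdiff : ∀ z ∈ B, DifferentiableAt ℝ (meanObjective μ Q P u) z := fun z hz =>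
    (hJ.differentiableOn one_ne_zero).differentiableAt (hB.mem_nhds hz)
  obtain ⟨zs, hzs, hmin⟩ := hcompact.exists_isMinOn hne (hJ.continuousOn.mono hsub)
  have hgrowth : ∀ z ∈ Zad, meanObjective μ Q P u zs + lam / 2 * ‖z - zs‖ ^ 2 ≤
      meanObjective μ Q P u z := fun z hz =>
    quadratic_growth hconvex hzs hz hmin (hdiff zs (hsub hzs)) (hsc zs (hsub hzs) z (hsub hz))
  refine ⟨zs, ⟨hzs, hmin⟩, fun z hz hzmin => ?_, fun ε hε => ?_⟩
  · have h1 := hgrowth z hz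
    have h2 : meanObjective μ Q P u z ≤ meanObjective μ Q P u zs := hzmin hzs
    have h3 : ‖z - zs‖ ^ 2 ≤ 0 := by nlinarith
    have h4 : ‖z - zs‖ = 0 := pow_eq_zero_iff two_ne_zero |>.1 (le_antisymm h3 (sq_nonneg _))
    exact sub_eq_zero.1 (norm_eq_zero.1 h4)
  -- The two entries give `η / lam ≤ ε` and `η ^ 2 / lam ≤ ε ^ 2` respectively.
  · set η := min (lam * ε) (√lam * ε) with hη
    have hη0 : 0 < η := by positivity
    obtain ⟨ru, rm, hru', hrm, g, hg, hreg, hclose⟩ :=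
      exists_rbno_gradient_close hB hne hcompact hsub hW hu hQ φ ψ bu bm hη0
    set s := rbno φ ψ bu bm hru' hrm g with hs
    -- No regularity of `P` is assumed directly. Writing the surrogate objective as the exact one
    -- plus a difference of integrals inherits differentiability from `hJ` and removes `P` from the
    -- gradient difference.
    have hmean : meanObjective μ Q P s = fun z =>
        (∫ m, Q (s m z) m z ∂μ) - (∫ m, Q (u m z) m z ∂μ) + meanObjective μ Q P u z := by
      funext z; simp only [meanObjective]; ring
    refine ⟨ru, rm, hru', hrm, g, hg, fun z hz => hreg.integrable hQ hB hW hz, ?_, ?_⟩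
    · rw [← hs, hmean]
      exact ((hreg.contDiffOn_integral hQ hB hW).sub (hru.contDiffOn_integral hQ hB hW)).add hJ
    · rintro zd ⟨hzd, -, hstat⟩
      have hzdB := hsub hzd
      have hd : fderiv ℝ (meanObjective μ Q P s) zd - fderiv ℝ (meanObjective μ Q P u) zd =
          (∫ m, totalDz Q s m zd ∂μ) - ∫ m, totalDz Q u m zd ∂μ := by
        have h := ((hreg.hasFDerivAt_integral hQ hB hW hzdB).sub
          (hru.hasFDerivAt_integral hQ hB hW hzdB)).add (hdiff zd hzdB).hasFDerivAt
        rw [(h.congr_of_eventuallyEq (.of_eq hmean)).fderiv, add_sub_cancel_right]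
      obtain ⟨h1, h2⟩ := stationary_close hlam hη0.le (hgrowth zd hzd)
        (hsc zd hzdB zs (hsub hzs)) (hstat zs hzs) (hd ▸ hclose zd hzd)
      constructor
      · refine h1.trans ((div_le_iff₀ hlam).2 ?_)
        rw [mul_comm]; exact min_le_left _ _
      · refine h2.trans ((div_le_iff₀ hlam).2 ?_)
        calc η ^ 2 ≤ (√lam * ε) ^ 2 := by gcongr; exact min_le_right _ _
          _ = ε ^ 2 * lam := by rw [mul_pow, Real.sq_sqrt hlam.le]; ring
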